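/- Setting. Consider $x_{t+1}=Ax_t+Bu_t$ on $\mathbb R^{d_x}\times\mathbb R^{d_u}$ (Euclidean norms, operator norm for $B$), with constraints $x_t\in\mathcal X$, $u_t\in\mathcal U$, where $\mathcal X,\mathcal U$ are closed, contain $0$, and $\mathcal U$ is bounded; put $B_u=\sup_{u\in\mathcal U}\|u\|$. Let $Q\succeq0$, $R\succ0$, let $P\succ 0$ solve the Riccati equation $P=A^\top PA-A^\top PB(R+B^\top PB)^{-1}B^\top PA+Q$, let $K=-(R+B^\top PB)^{-1}B^\top PA$ and $\pi^{\mathrm{lqr}}(x)=Kx$. Let $\varepsilon\in(0,1)$, $\mathcal W=\{w:\|w\|\le\varepsilon\}$, and let $\mathcal E$ be a neighbourhood of $0$ with $(A+BK)\mathcal E+\mathcal W\subseteq\mathcal E$. With $\mathcal S\ominus\mathcal Y=\{x\in \mathcal S: x+\mathcal Y\subseteq\mathcal S\}$ put $\bar{\mathcal X}=\mathcal X\ominus\mathcal E$, $\bar{\mathcal U}=\mathcal U\ominus K\mathcal E$. Let $\bar{\mathcal O}_\infty$ be the largest set $\mathcal O\subseteq\bar{\mathcal X}$ such that $(A+BK)^tx\in\mathcal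 O$ and $K(A+BK)^tx\in\bar{\mathcal U}$ for all $x\in\mathcal O$, $t\ge0$. Fix $N\ge1$. Call $(x_0,u_0,\dots,u_{N-1})$ feasible if $x_k\in\bar{\mathcal X}$, $u_k\in\bar{\mathcal U}$ for $k<N$ and $x_N\in\bar{\mathcal O}_\infty$, where $x_{k+1}=Ax_k+Bu_k$; let $\bar{\mathcal X}_0$ be the set of $x_0$ admitting such $u$. For $x\in(\bar{\mathcal X}_0+\mathcal E)\cap\mathcal X$ let $(\bar x_0,\bar u_0,\dots,\bar u_{N-1})$ be a minimizer of $\sum_{k<N}(x_k^\top Qx_k+u_k^\top Ru_k)+x_N^\top Px_N$ over all feasible $(x_0,u)$ with $x-x_0\in\mathcal E$; the robust MPC controller is $\pi_\star(x)=\bar u_0+K(x-\bar x_0)$. Outside this domain $\pi_\star$ is extended arbitrarily. Let $\mathcal D$ be a probability distribution with bounded support, almost surely in $\bar{\mathcal X}_0$. Let $\Pi\ni\pi_\star$ be a finite set of measurable controllers with $\pi(x)\in\mathcal U$ for all $\pi\in\Pi$, $x\in\mathcal X$. Let $\tau^\star_\infty\in\{1,2,\dots\}\cup\{\infty\}$ be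 the least $\tau\ge1$ such that for $\mathcal D$-almost every $x_0$ and all disturbances $w_t\in\mathcal W$ the trajectory $x_{t+1}=Ax_t+B\pi_\star(x_t)+w_t$ satisfies $x_\tau\in\bar{\mathcal O}_\infty$ ($\infty$ if there is none). Forward-Switch. Let $T\ge1$, $c=\sum_{t\ge1}1/(t\ln^2(t+1))$ and $n_t=\lceil c\,n\,t\lceil\ln^2(t+1)\rceil+n\rceil$. At stage $t=0,1,\dots,T-1$ draw $n_t$ fresh i.i.d. initial states from $\mathcal D$, run the policies $\hat\pi_0,\dots,\hat\pi_{t-1}$ learned so far to obtain states $\hat x_t^{(i)}$, and let $\hat\pi_t$ minimize $\frac1{n_t}\sum_i\|\pi_\star(\hat x_t^{(i)})-\pi(\hat x_t^{(i)})\|$ over $\pi\in\Pi$. Then draw $\ell$ further fresh i.i.d. initial states from $\mathcal D$ and run $\hat\pi_0,\dots,\hat\pi_t$; if all $\ell$ states at time $t+1$ lie in $\bar{\mathcal O}_\infty$, stop with $\hat\tau_\infty=t+1$. If this never happens, $\hat\tau_\infty=T$. The output $\tilde\pi$ uses $\hat\pi_t$ for $t<\hat\tau_\infty$ and $\pi^{\mathrm{lqr}}$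 for $t\ge\hat\tau_\infty$. Write $\hat x_t$ for the state at time $t$ under $\hat\pi$ from an initial state $x_0$. Theorem. Let $\delta\in(0,1)$, $\ell\ge\frac{10\ln(T/\delta)}{\delta}$ and $n\ge\frac{14\,\ell\,\|B\|\,B_u\ln(2T\ell|\Pi|/\delta)}{\varepsilon\delta}$. (0) If $Q\succ0$ and $0$ is an interior point of $\bar{\mathcal O}_\infty\ominus\mathcal E$, then $\tau_\infty^\star<\infty$. Moreover there is an event of probability at least $1-3\delta$ over the training on which all of the following hold, probabilities being over $x_0\sim\mathcal D$ with the trained $\hat\pi,\hat\tau_\infty$ fixed. (i) $\hat\tau_\infty\le\tau_\infty^\star$. (ii) If $\tau_\infty^\star\le T$ or $\hat\tau_\infty<T$, then $\Pr[\hat x_{\hat\tau_\infty}\in\bar{\mathcal O}_\infty]\ge1-\delta$. (iii) $\Pr[\forall t<\hat\tau_\infty:\ \|B\|\,\|\pi_\star(\hat x_t)-\hat\pi_t(\hat x_t)\|\le\varepsilon]\ge1-\delta$. (iv) For every $x_0\in\bar{\mathcal X}_0$ in the two events of (ii) and (iii), the trajectory of $\tilde\pi$ from $x_0$ satisfies $x_t\in\mathcal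 X$ and $\tilde\pi_t(x_t)\in\mathcal U$ for all $t\ge0$. -/

import Mathlib

open MeasureTheory ProbabilityTheory
open scoped Matrix Matrix.Norms.L2Operator

noncomputable section

/-- `ℝᵈ` with the Euclidean norm. -/
abbrev Vec (d : ℕ) := EuclideanSpace ℝ (Fin d)

/-- A (time-invariant) controller: a map from states to inputs. -/
abbrev Policy (dx du : ℕ) := Vec dx → Vec du

/-- The quadratic form `xᵀ M x`. -/
def quad {d : ℕ} (M : Matrix (Fin d) (Fin d) ℝ) (x : Vec d) : ℝ :=
  x.ofLp ⬝ᵥ (M *ᵥ x.ofLp)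

/-- The set difference `S ⊖ Y = {x ∈ S | x + Y ⊆ S}`. -/
def erode {d : ℕ} (S Y : Set (Vec d)) : Set (Vec d) :=
  {x | x ∈ S ∧ ∀ y ∈ Y, x + y ∈ S}

/-- The data of a robust MPC problem: system matrices `A, B`, cost matrices `Q, R`, Riccati
matrix `P`, horizon `N`, constraint sets `X, U`, disturbance radius `ε` (so that the disturbance
set is the closed ball of radius `ε`) and a set `E` that is to be disturbance invariant. -/
structure MPCData (dx du : ℕ) where
  A : Matrix (Fin dx) (Fin dx) ℝ
  B : Matrix (Fin dx) (Fin du) ℝ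
  Q : Matrix (Fin dx) (Fin dx) ℝ
  R : Matrix (Fin du) (Fin du) ℝ
  P : Matrix (Fin dx) (Fin dx) ℝ
  N : ℕ
  X : Set (Vec dx)
  U : Set (Vec du)
  ε : ℝ
  E : Set (Vec dx)

namespace MPCData

variable {dx du : ℕ} (S : MPCData dx du)

/-- One step `A x + B u` of the dynamics. -/
def step (x : Vec dx) (u : Vec du) : Vec dx :=
  WithLp.toLp 2 (S.A *ᵥ x.ofLp + S.B *ᵥ u.ofLp)

/-- The LQR gain `K = -(R + Bᵀ P B)⁻¹ Bᵀ P A`. -/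
def K : Matrix (Fin du) (Fin dx) ℝ :=
  -((S.R + S.Bᵀ * S.P * S.B)⁻¹ * S.Bᵀ * S.P * S.A)

/-- The unconstrained LQR controller `x ↦ K x`. -/
def lqr : Policy dx du := fun x => WithLp.toLp 2 (S.K *ᵥ x.ofLp)

/-- The discrete algebraic Riccati equation. -/
def Riccati : Prop :=
  S.P = S.Aᵀ * S.P * S.A
    - S.Aᵀ * S.P * S.B * (S.R + S.Bᵀ * S.P * S.B)⁻¹ * S.Bᵀ * S.P * S.A + S.Q

/-- `E` is disturbance invariant for the closed ball `W` of radius `ε`: it is a neighbourhood of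
the origin with `(A + B K) E + W ⊆ E`. -/
def IsDisturbanceInvariant : Prop :=
  S.E ∈ nhds (0 : Vec dx) ∧
    ∀ e ∈ S.E, ∀ w ∈ Metric.closedBall (0 : Vec dx) S.ε, S.step e (S.lqr e) + w ∈ S.E

/-- Standing assumptions: `Q ⪰ 0`, `R ≻ 0`, `P` is a positive definite solution of the Riccati
equation, the horizon is nonempty, `X` and `U` are closed and contain the origin, `U` is bounded
(so that `sup_{u ∈ U} ‖u‖` is finite) and `E` is disturbance invariant. -/
structure Standing : Prop where
  Q_psd : S.Q.PosSemidef
  R_pd : S.R.PosDef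
  P_pd : S.P.PosDef
  riccati : S.Riccati
  N_pos : 1 ≤ S.N
  X_closed : IsClosed S.X
  X_zero : (0 : Vec dx) ∈ S.X
  U_closed : IsClosed S.U
  U_zero : (0 : Vec du) ∈ S.U
  U_bdd : Bornology.IsBounded S.U
  E_inv : S.IsDisturbanceInvariant

/-- `sup_{u ∈ U} ‖u‖`. -/
def inputBound : ℝ := sSup ((fun u : Vec du => ‖u‖) '' S.U)

/-! ### Constraint sets, terminal set and the robust MPC controller -/

/-- The tightened state constraints `X ⊖ E`. -/
def Xbar : Set (Vec dx) := erode S.X S.E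

/-- The tightened input constraints `U ⊖ K E`. -/
def Ubar : Set (Vec du) := erode S.U (S.lqr '' S.E)

/-- State at time `t` of `x ↦ (A + B K) x` started at `x`. -/
def lqrTraj (x : Vec dx) : ℕ → Vec dx
  | 0 => x
  | t + 1 => S.step (lqrTraj x t) (S.lqr (lqrTraj x t))

/-- Positive invariance of `O` for the LQR controller with respect to `(X', U')`. -/
def IsPosInvariant (X' : Set (Vec dx)) (U' : Set (Vec du)) (O : Set (Vec dx)) : Prop :=
  O ⊆ X' ∧ ∀ x ∈ O, ∀ t, S.lqrTraj x t ∈ O ∧ S.lqr (S.lqrTraj x t) ∈ U'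

/-- The maximal positively invariant set: the union of all positively invariant sets. -/
def maxPosInvariant (X' : Set (Vec dx)) (U' : Set (Vec du)) : Set (Vec dx) :=
  ⋃₀ {O | S.IsPosInvariant X' U' O}

/-- The maximal positively invariant set for the tightened constraints, which is also the
terminal set of the tightened MPC problem. -/
def Obar : Set (Vec dx) := S.maxPosInvariant S.Xbar S.Ubar

/-- States that can be steered into the terminal set in `k` steps within the tightened
constraints. -/
def feasibleIn : ℕ → Set (Vec dx)
  | 0 => S.Obar
  | k + 1 => {x | x ∈ S.Xbar ∧ ∃ u ∈ S.Ubar, S.step x u ∈ feasibleIn k}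

/-- The feasible domain of the tightened MPC problem. -/
def feasibleDomain : Set (Vec dx) := S.feasibleIn S.N

/-- Nominal state at time `k` from `x₀` under the inputs `u 0, u 1, …`. -/
def nominal (x₀ : Vec dx) (u : ℕ → Vec du) : ℕ → Vec dx
  | 0 => x₀
  | k + 1 => S.step (nominal x₀ u k) (u k)

/-- The `N`-step objective with terminal cost `xᵀ P x`. Only `u 0, …, u (N - 1)` matter. -/
def cost (x₀ : Vec dx) (u : ℕ → Vec du) : ℝ :=
  (∑ k ∈ Finset.range S.N, (quad S.Q (S.nominal x₀ u k) + quad S.R (u k)))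
    + quad S.P (S.nominal x₀ u S.N)

/-- The constraints of the tightened MPC problem. -/
def MPCFeasible (x₀ : Vec dx) (u : ℕ → Vec du) : Prop :=
  (∀ k < S.N, S.nominal x₀ u k ∈ S.Xbar ∧ u k ∈ S.Ubar) ∧ S.nominal x₀ u S.N ∈ S.Obar

/-- The constraints of the robust MPC problem at the state `x`, with variables `x₀` and `u`. -/
def RMPCFeasible (x x₀ : Vec dx) (u : ℕ → Vec du) : Prop :=
  S.MPCFeasible x₀ u ∧ x - x₀ ∈ S.E

/-- `(x₀, u)` is an optimal solution of the robust MPC problem at the state `x`. -/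
def RMPCOptimal (x x₀ : Vec dx) (u : ℕ → Vec du) : Prop :=
  S.RMPCFeasible x x₀ u ∧ ∀ x₀' u', S.RMPCFeasible x x₀' u' → S.cost x₀ u ≤ S.cost x₀' u'

/-- The states at which the robust MPC problem is posed: the sum of the feasible domain and `E`,
intersected with `X`. -/
def rmpcDomain : Set (Vec dx) :=
  {x | x ∈ S.X ∧ ∃ x₀ ∈ S.feasibleDomain, x - x₀ ∈ S.E}

/-- `π` is the robust MPC controller: where the robust MPC problem is posed,
`π x = ū₀ + K (x - x̄₀)` for an optimal solution `(x̄₀, ū)`. Elsewhere `π` is any extension. -/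
def IsRobustMPC (π : Policy dx du) : Prop :=
  ∀ x ∈ S.rmpcDomain, ∃ (x₀ : Vec dx) (u : ℕ → Vec du),
    S.RMPCOptimal x x₀ u ∧ π x = u 0 + S.lqr (x - x₀)

/-! ### Trajectories and the time to reach the invariant set -/

/-- State at time `t` from `x₀` under the time-varying controller `π`. -/
def traj (π : ℕ → Policy dx du) (x₀ : Vec dx) : ℕ → Vec dx
  | 0 => x₀
  | t + 1 => S.step (traj π x₀ t) (π t (traj π x₀ t))

/-- State at time `t` from `x₀` under the controller `π` with additive disturbances `w`. -/
def disturbedTraj (π : Policy dx du) (w : ℕ → Vec dx) (x₀ : Vec dx) : ℕ → Vec dx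
  | 0 => x₀
  | t + 1 => S.step (disturbedTraj π w x₀ t) (π (disturbedTraj π w x₀ t)) + w t

/-- The positive times at which the closed loop with `π` is in the invariant set for almost all
initial states, whatever the disturbances of norm at most `ε`. -/
def reachTimes (D : Measure (Vec dx)) (π : Policy dx du) : Set ℕ :=
  {τ | 1 ≤ τ ∧ ∀ᵐ x₀ ∂D, ∀ w : ℕ → Vec dx, (∀ t, ‖w t‖ ≤ S.ε) →
    S.disturbedTraj π w x₀ τ ∈ S.Obar}

/-- The least such time (`⊤` if there is none). -/
def tauStar (D : Measure (Vec dx)) (π : Policy dx du) : ℕ∞ :=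
  ⨅ τ ∈ S.reachTimes D π, (τ : ℕ∞)

/-! ### The algorithm -/

/-- The switching time: the first `t + 1` such that, at the end of stage `t`, all the `ℓ` fresh
trajectories with initial states `v t i` are in the invariant set at time `t + 1`; it is `T` if
this does not happen up to time `T`. -/
def switchTime (T ℓ : ℕ) (π : ℕ → Policy dx du) (v : ℕ → Fin ℓ → Vec dx) : ℕ :=
  sInf ({τ | ∃ t, τ = t + 1 ∧ ∀ i, S.traj π (v t i) (t + 1) ∈ S.Obar} ∪ {T})

/-- The switched controller: the learned one before time `τ`, LQR from then on. -/
def switched (π : ℕ → Policy dx du) (τ : ℕ) : ℕ → Policy dx du :=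
  fun t => if t < τ then π t else S.lqr

/-- Empirical imitation loss at stage `t` of the candidate `p`, over the initial states `x i`, when
`π` are the policies learned so far. -/
def empLoss (expert : Policy dx du) (π : ℕ → Policy dx du) (t : ℕ) {m : ℕ}
    (x : Fin m → Vec dx) (p : Policy dx du) : ℝ :=
  (1 / (m : ℝ)) * ∑ i, ‖expert (S.traj π (x i) t) - p (S.traj π (x i) t)‖

end MPCData

/-- `c = ∑_{t ≥ 1} 1 / (t ln² (t + 1))`. -/
def sampleConst : ℝ := ∑' k : ℕ, 1 / (((k : ℝ) + 1) * Real.log ((k : ℝ) + 2) ^ 2)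

/-- The number of samples at stage `t`: `c n t ⌈ln² (t + 1)⌉ + n`, rounded up. -/
def sampleSize (n t : ℕ) : ℕ :=
  ⌈sampleConst * (n : ℝ) * (t : ℝ) * (⌈Real.log ((t : ℝ) + 1) ^ 2⌉₊ : ℝ) + (n : ℝ)⌉₊

/-- A run of Forward-Switch on the probability space `(Ω, μ)`, with base sample size `n`, horizon
`T`, `ℓ` test trajectories per stage, finite policy class `Pol`, expert `expert` and initial
distribution `D`. -/
structure ForwardSwitch {dx du : ℕ} (S : MPCData dx du) (D : Measure (Vec dx))
    (Pol : Finset (Policy dx du)) (expert : Policy dx du) (n T ℓ : ℕ)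
    {Ω : Type*} [mΩ : MeasurableSpace Ω] (μ : Measure Ω) where
  /-- Initial states drawn for training at stage `t`. -/
  train : (t : ℕ) → Ω → Fin (sampleSize n t) → Vec dx
  /-- Initial states drawn for the test at the end of stage `t`. -/
  test : ℕ → Ω → Fin ℓ → Vec dx
  /-- The policy learned at stage `t`. From the switching time on it is not used. -/
  policy : ℕ → Ω → Policy dx du
  /-- What is known when stage `t` begins. -/
  before : ℕ → MeasurableSpace Ω
  /-- What is known once the policy of stage `t` has been learned. -/
  after : ℕ → MeasurableSpace Ω
  before_le_after : ∀ t, before t ≤ after t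
  after_le_before : ∀ t, after t ≤ before (t + 1)
  after_le : ∀ t, after t ≤ mΩ
  /-- The training samples of a stage are i.i.d. from `D` and fresh. -/
  train_meas : ∀ t, Measurable[after t] (train t)
  train_law : ∀ t, μ.map (train t) = Measure.pi fun _ => D
  train_indep : ∀ t, Indep (MeasurableSpace.comap (train t) inferInstance) (before t) μ
  /-- The test samples of a stage are i.i.d. from `D` and fresh. -/
  test_meas : ∀ t, Measurable[before (t + 1)] (test t)
  test_law : ∀ t, μ.map (test t) = Measure.pi fun _ => D
  test_indep : ∀ t, Indep (MeasurableSpace.comap (test t) inferInstance) (after t) μ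
  /-- The policy of stage `t` is chosen in `Pol` from what is known at the end of stage `t`. -/
  policy_mem : ∀ t ω, policy t ω ∈ Pol
  policy_meas : ∀ t, ∀ p ∈ Pol, MeasurableSet[after t] {ω | policy t ω = p}
  /-- As long as the switch has not occurred, it minimizes the empirical loss over `Pol`. -/
  erm : ∀ t ω, t < S.switchTime T ℓ (fun s => policy s ω) (fun s => test s ω) →
    ∀ p ∈ Pol, S.empLoss expert (fun s => policy s ω) t (train t ω) (policy t ω)
      ≤ S.empLoss expert (fun s => policy s ω) t (train t ω) p

namespace ForwardSwitch

variable {dx du : ℕ} {S : MPCData dx du} {D : Measure (Vec dx)} {Pol : Finset (Policy dx du)}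
  {expert : Policy dx du} {n T ℓ : ℕ} {Ω : Type*} [MeasurableSpace Ω] {μ : Measure Ω}
  (F : ForwardSwitch S D Pol expert n T ℓ μ)

/-- The learned time-varying controller. -/
def learned (ω : Ω) : ℕ → Policy dx du := fun t => F.policy t ω

/-- The switching time of the run. -/
def tauHat (ω : Ω) : ℕ := S.switchTime T ℓ (F.learned ω) (fun t => F.test t ω)

/-- The initial states from which the learned controller is in the invariant set at the
switching time. -/
def reachEvent (ω : Ω) : Set (Vec dx) :=
  {x₀ | S.traj (F.learned ω) x₀ (F.tauHat ω) ∈ S.Obar}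

/-- The initial states from which the learned inputs are within `ε / ‖B‖` of the expert's before
the switching time; there is no condition if `B = 0`. -/
def closeEvent (ω : Ω) : Set (Vec dx) :=
  {x₀ | ∀ t < F.tauHat ω,
    ‖S.B‖ * ‖expert (S.traj (F.learned ω) x₀ t) - F.learned ω t (S.traj (F.learned ω) x₀ t)‖
      ≤ S.ε}

/-- The output of the algorithm. -/
def output (ω : Ω) : ℕ → Policy dx du := S.switched (F.learned ω) (F.tauHat ω)

end ForwardSwitch

end

/-!
Feasibility of the robust MPC problem is preserved by any disturbance of norm at most `ε`, so the
expert's closed loop is robustly safe; moreover the optimal cost, as a function of the nominal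
state, decreases by the stage cost at each step, so the expert enters the terminal set after a
bounded time. A trajectory along which the learned inputs are within `ε / ‖B‖` of the expert's is a
trajectory of the expert with disturbances of norm at most `ε`: it inherits safety and reaching
time.

The expert lies in the class, so the empirical minimizer has zero loss. As the training sample of
stage `t` is independent of the policies that generate the states, a union bound over the class
bounds the probability of disagreement at time `t` by `log a / sampleSize n t`, off an event of
probability `|Pol| / a`; the sum over all stages is at most `2 log a / n`. If `2 ‖B‖ sup ‖u‖ ≤ ε`
this bound is not available, the hypothesis on `n` being too weak, but then any two admissible
inputs are within `ε / ‖B‖` of each other.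
-/

section Probability

variable {Ω α ι : Type*} {m mΩ : MeasurableSpace Ω} [MeasurableSpace α]

lemma one_sub_measureReal_compl_le {μ : Measure Ω} [IsProbabilityMeasure μ] (s : Set Ω) :
    1 - μ.real sᶜ ≤ μ.real s := by
  have h := measureReal_union_le (μ := μ) s sᶜ
  rw [Set.union_compl_self, probReal_univ] at h
  linarith

lemma exists_measurableSet_subset_compl_of_measureReal_le {μ : Measure Ω} [IsProbabilityMeasure μ]
    {s : Set Ω} {η : ℝ} (hs : μ.real s ≤ η) :
    ∃ G, MeasurableSet G ∧ 1 - η ≤ μ.real G ∧ G ⊆ sᶜ := by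
  have hmeas := measurableSet_toMeasurable μ s
  refine ⟨(toMeasurable μ s)ᶜ, hmeas.compl, ?_, Set.compl_subset_compl.2 (subset_toMeasurable μ s)⟩
  rw [probReal_compl_eq_one_sub hmeas, Measure.real, measure_toMeasurable]
  exact sub_le_sub_left hs 1

lemma measureReal_biUnion_finset_le_card_mul {μ : Measure Ω} (I : Finset ι) {s : ι → Set Ω} {β : ℝ}
    (hs : ∀ i ∈ I, μ.real (s i) ≤ β) : μ.real (⋃ i ∈ I, s i) ≤ I.card * β :=
  calc μ.real (⋃ i ∈ I, s i) ≤ ∑ i ∈ I, μ.real (s i) := measureReal_biUnion_finset_le I s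
    _ ≤ I.card * β := by simpa only [nsmul_eq_mul] using Finset.sum_le_card_nsmul I _ β hs

lemma measureReal_and_mem_le {μ : Measure Ω} {p : Prop} {s : Set Ω} {β : ℝ} (hβ : 0 ≤ β)
    (h : p → μ.real s ≤ β) : μ.real {ω | p ∧ ω ∈ s} ≤ β := by
  by_cases hp : p
  · simpa only [hp, true_and, Set.ofPred_mem_eq] using h hp
  · simpa only [hp, false_and, Set.ofPred_false, measureReal_empty] using hβ

lemma measureReal_pi_forall_mem_le [Fintype ι] {D : Measure α} [SigmaFinite D] {A : Set α} {η : ℝ}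
    (hA : D.real A ≤ 1 - η) :
    (Measure.pi fun _ : ι => D).real {x | ∀ i, x i ∈ A} ≤ Real.exp (-(η * Fintype.card ι)) := by
  have hset : {x : ι → α | ∀ i, x i ∈ A} = Set.univ.pi fun _ => A := by
    ext x
    simp
  calc (Measure.pi fun _ : ι => D).real {x | ∀ i, x i ∈ A} = D.real A ^ Fintype.card ι := by
        rw [hset, Measure.real, Measure.pi_pi, Finset.prod_const, ENNReal.toReal_pow,
          Finset.card_univ, Measure.real]
    _ ≤ Real.exp (-η) ^ Fintype.card ι := by
        gcongr
        exact hA.trans (Real.one_sub_le_exp_neg η)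
    _ = Real.exp (-(η * Fintype.card ι)) := by
        rw [← Real.exp_nat_mul]
        ring_nf

lemma measureReal_pi_exists_mem_le [Fintype ι] {D : Measure α} [IsProbabilityMeasure D] {A : Set α}
    (hA : MeasurableSet A) :
    (Measure.pi fun _ : ι => D).real {x | ∃ i, x i ∈ A} ≤ Fintype.card ι * D.real A := by
  have hset : {x : ι → α | ∃ i, x i ∈ A} =
      ⋃ i ∈ (Finset.univ : Finset ι), Function.eval i ⁻¹' A := by
    ext x
    simp
  rw [hset]
  exact measureReal_biUnion_finset_le_card_mul _ fun i _ =>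
    ((measurePreserving_eval (fun _ : ι => D) i).measureReal_preimage hA.nullMeasurableSet).le

lemma measurableSet_forall_mem [Countable ι] {A : Set α} (hA : MeasurableSet A) :
    MeasurableSet {x : ι → α | ∀ i, x i ∈ A} := by
  rw [Set.ofPred_forall]
  exact MeasurableSet.iInter fun i => measurable_pi_apply i hA

lemma measurableSet_exists_mem [Countable ι] {A : Set α} (hA : MeasurableSet A) :
    MeasurableSet {x : ι → α | ∃ i, x i ∈ A} := by
  rw [Set.ofPred_exists]
  exact MeasurableSet.iUnion fun i => measurable_pi_apply i hA

variable {μ : Measure Ω} [IsProbabilityMeasure μ] {X : Ω → α}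

lemma measureReal_mem_le_of_indep [Finite ι] (hX : Measurable X) (hm : m ≤ mΩ)
    (hind : Indep (MeasurableSpace.comap X inferInstance) m μ) {f : Ω → ι}
    (hf : ∀ i, MeasurableSet[m] (f ⁻¹' {i})) {b : ι → Set α} (hb : ∀ i, MeasurableSet (b i))
    {β : ℝ} (hβ : ∀ i, (μ.map X).real (b i) ≤ β) : μ.real {ω | X ω ∈ b (f ω)} ≤ β := by
  have := Fintype.ofFinite ι
  have hsub : {ω | X ω ∈ b (f ω)} ⊆ ⋃ i ∈ (Finset.univ : Finset ι), X ⁻¹' b i ∩ f ⁻¹' {i} :=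
    fun ω hω => Set.mem_biUnion (Finset.mem_coe.2 (Finset.mem_univ (f ω))) ⟨hω, rfl⟩
  have hprod (i : ι) :
      μ.real (X ⁻¹' b i ∩ f ⁻¹' {i}) = (μ.map X).real (b i) * μ.real (f ⁻¹' {i}) := by
    rw [map_measureReal_apply hX (hb i), Measure.real, Measure.real, Measure.real,
      (Indep_iff _ _ _).1 hind _ _ ⟨b i, hb i, rfl⟩ (hf i), ENNReal.toReal_mul]
  have htotal : ∑ i, μ.real (f ⁻¹' {i}) = 1 := by
    rw [sum_measureReal_preimage_singleton _ fun i _ => hm _ (hf i)]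
    simp
  calc μ.real {ω | X ω ∈ b (f ω)} ≤ ∑ i, μ.real (X ⁻¹' b i ∩ f ⁻¹' {i}) :=
        (measureReal_mono hsub (measure_ne_top _ _)).trans (measureReal_biUnion_finset_le _ _)
    _ ≤ ∑ i, β * μ.real (f ⁻¹' {i}) := by
        gcongr with i
        rw [hprod]
        gcongr
        exact hβ i
    _ = β := by rw [← Finset.mul_sum, htotal, mul_one]

lemma measureReal_mem_le_of_indep_of_dependsOn {κ γ : Type*} (hX : Measurable X) (hm : m ≤ mΩ)
    (hind : Indep (MeasurableSpace.comap X inferInstance) m μ) {I : Finset κ} {K : Finset γ}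
    {Y : Ω → κ → γ} (hYK : ∀ ω k, Y ω k ∈ K)
    (hY : ∀ k ∈ I, ∀ p ∈ K, MeasurableSet[m] {ω | Y ω k = p}) {b : (κ → γ) → Set α}
    (hdep : DependsOn b I) (hb : ∀ y, (∀ k, y k ∈ K) → MeasurableSet (b y)) {β : ℝ}
    (hβ : ∀ y, (∀ k, y k ∈ K) → (μ.map X).real (b y) ≤ β) : μ.real {ω | X ω ∈ b (Y ω)} ≤ β := by
  classical
  obtain ⟨ω₀⟩ := nonempty_of_isProbabilityMeasure μ
  let extend (q : I → K) : κ → γ := fun k => if h : k ∈ I then q ⟨k, h⟩ else Y ω₀ k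
  let restrict (ω : Ω) : I → K := fun k => ⟨Y ω k, hYK ω k⟩
  have hext (q : I → K) (k : κ) : extend q k ∈ K := by
    by_cases hk : k ∈ I
    · simpa only [extend, dif_pos hk] using (q ⟨k, hk⟩).2
    · simp only [extend, dif_neg hk, hYK]
  have hmeas (q : I → K) : MeasurableSet[m] (restrict ⁻¹' {q}) := by
    have : restrict ⁻¹' {q} = ⋂ k : I, {ω | Y ω k = q k} := by
      ext ω
      simp [restrict, funext_iff, Subtype.ext_iff]
    rw [this]
    exact MeasurableSet.iInter fun k => hY k k.2 _ (q k).2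
  have hrestrict (ω : Ω) : b (extend (restrict ω)) = b (Y ω) :=
    hdep fun k hk => dif_pos (Finset.mem_coe.1 hk)
  simp only [← hrestrict]
  exact measureReal_mem_le_of_indep hX hm hind hmeas (fun q => hb _ (hext q))
    fun q => hβ _ (hext q)

end Probability

lemma exists_lt_of_add_le {V g : ℕ → ℝ} {a : ℝ} {m : ℕ} (hV : ∀ t, 0 ≤ V t)
    (hdec : ∀ t, V (t + 1) + g t ≤ V t) (h0 : V 0 < m * a) : ∃ t < m, g t < a := by
  have hsum : V m + ∑ t ∈ Finset.range m, g t ≤ V 0 := by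
    clear h0
    induction m with
    | zero => simp
    | succ m ih =>
      rw [Finset.sum_range_succ]
      linarith [hdec m]
  have hlt : ∑ t ∈ Finset.range m, g t < ∑ _t ∈ Finset.range m, a := by
    rw [Finset.sum_const, Finset.card_range, nsmul_eq_mul]
    linarith [hV m]
  simpa only [Finset.mem_range] using Finset.exists_lt_of_sum_lt hlt

lemma lt_of_add_le {V g : ℕ → ℝ} {a b : ℝ} {m : ℕ} (hg : ∀ t, 0 ≤ g t) (hgV : ∀ t, g t ≤ V t)
    (hdec : ∀ t, V (t + 1) + g t ≤ V t) (hlt : ∀ t, g t < b → V t < a) (h0 : V 0 < m * b) :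
    V m < a := by
  have hanti : Antitone V := antitone_nat_of_succ_le fun t =>
    (le_add_of_nonneg_right (hg t)).trans (hdec t)
  obtain ⟨t, htm, htb⟩ := exists_lt_of_add_le (fun t => (hg t).trans (hgV t)) hdec h0
  exact (hanti htm.le).trans_lt (hlt t htb)

section SampleSize

lemma summable_one_div_mul_log_sq :
    Summable fun k : ℕ => 1 / (((k : ℝ) + 1) * Real.log ((k : ℝ) + 2) ^ 2) := by
  let f : ℕ → ℝ := fun k => 1 / (k * Real.log (k + 1) ^ 2)
  have hshift : (fun k : ℕ => 1 / (((k : ℝ) + 1) * Real.log ((k : ℝ) + 2) ^ 2)) =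
      fun k => f (k + 1) := by
    funext k
    simp only [f, Nat.cast_add_one, add_assoc, one_add_one_eq_two]
  have hmono ⦃i j : ℕ⦄ (hi : 0 < i) (hij : i ≤ j) : f j ≤ f i := by
    have hi' : (1 : ℝ) ≤ i := Nat.one_le_cast.2 hi
    have hlog : 0 < Real.log (i + 1) := Real.log_pos (by linarith)
    dsimp only [f]
    gcongr
  have hcond (k : ℕ) :
      2 ^ (k + 1) * f (2 ^ (k + 1)) ≤ 1 / Real.log 2 ^ 2 * (1 / ((k + 1 : ℕ) : ℝ) ^ 2) := by
    have : 0 < Real.log 2 := Real.log_pos one_lt_two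
    have hlog : (k + 1 : ℕ) * Real.log 2 ≤ Real.log (2 ^ (k + 1) + 1) := by
      rw [← Real.log_pow]
      exact Real.log_le_log (by positivity) (by linarith)
    calc 2 ^ (k + 1) * f (2 ^ (k + 1)) = 1 / Real.log (2 ^ (k + 1) + 1) ^ 2 := by
          simp only [f, Nat.cast_pow, Nat.cast_ofNat]
          field_simp
      _ ≤ 1 / ((k + 1 : ℕ) * Real.log 2) ^ 2 := by gcongr
      _ = _ := by rw [mul_pow, mul_comm, one_div_mul_one_div]
  rw [hshift, summable_nat_add_iff 1, ← summable_condensed_iff_of_nonneg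
    (fun k => by positivity) hmono, ← summable_nat_add_iff 1]
  refine Summable.of_nonneg_of_le (fun k => by positivity) hcond (Summable.mul_left _ ?_)
  exact (summable_nat_add_iff 1).2 (Real.summable_one_div_nat_pow.2 one_lt_two)

lemma sampleConst_pos : 0 < sampleConst := by
  have : 0 < Real.log 2 := Real.log_pos one_lt_two
  refine summable_one_div_mul_log_sq.tsum_pos (fun k => by positivity) 0 ?_
  simp only [Nat.cast_zero, zero_add]
  positivity

lemma le_sampleSize (n t : ℕ) : n ≤ sampleSize n t := by
  have hc := sampleConst_pos
  have h : (n : ℝ) ≤ sampleSize n t :=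
    (le_add_of_nonneg_left (by positivity)).trans (Nat.le_ceil _)
  exact_mod_cast h

lemma one_div_sampleSize_succ_le {n : ℕ} (hn : 0 < n) (t : ℕ) :
    1 / (sampleSize n (t + 1) : ℝ) ≤
      1 / (sampleConst * n) * (1 / (((t : ℝ) + 1) * Real.log ((t : ℝ) + 2) ^ 2)) := by
  have hc := sampleConst_pos
  have hlog : 0 < Real.log ((t : ℝ) + 2) := Real.log_pos (by linarith [t.cast_nonneg (α := ℝ)])
  have hcast : ((t + 1 : ℕ) : ℝ) + 1 = (t : ℝ) + 2 := by
    push_cast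
    ring
  rw [one_div_mul_one_div]
  refine one_div_le_one_div_of_le (by positivity) ?_
  calc sampleConst * n * (((t : ℝ) + 1) * Real.log ((t : ℝ) + 2) ^ 2)
      = sampleConst * n * ((t + 1 : ℕ) : ℝ) * Real.log (((t + 1 : ℕ) : ℝ) + 1) ^ 2 := by
        rw [hcast, Nat.cast_add_one, ← mul_assoc]
    _ ≤ sampleConst * n * ((t + 1 : ℕ) : ℝ) * ⌈Real.log (((t + 1 : ℕ) : ℝ) + 1) ^ 2⌉₊ := by
        gcongr
        exact Nat.le_ceil _
    _ ≤ _ := (le_add_of_nonneg_right n.cast_nonneg).trans (Nat.le_ceil _)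

lemma sum_one_div_sampleSize_le {n : ℕ} (hn : 0 < n) (m : ℕ) :
    ∑ t ∈ Finset.range m, 1 / (sampleSize n t : ℝ) ≤ 2 / n := by
  have hc := sampleConst_pos
  have hfirst : 1 / (sampleSize n 0 : ℝ) ≤ 1 / n := by
    gcongr
    exact le_sampleSize n 0
  have hrest : ∑ t ∈ Finset.range m, 1 / (sampleSize n (t + 1) : ℝ) ≤ 1 / n :=
    calc _ ≤ ∑ t ∈ Finset.range m,
          1 / (sampleConst * n) * (1 / (((t : ℝ) + 1) * Real.log ((t : ℝ) + 2) ^ 2)) :=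
          Finset.sum_le_sum fun t _ => one_div_sampleSize_succ_le hn t
      _ ≤ 1 / (sampleConst * n) * sampleConst := by
          rw [← Finset.mul_sum]
          gcongr
          exact summable_one_div_mul_log_sq.sum_le_tsum _ fun k _ => by positivity
      _ = 1 / n := by field_simp
  calc ∑ t ∈ Finset.range m, 1 / (sampleSize n t : ℝ)
      ≤ ∑ t ∈ Finset.range (m + 1), 1 / (sampleSize n t : ℝ) :=
        Finset.sum_le_sum_of_subset_of_nonneg (Finset.range_mono m.le_succ)
          fun _ _ _ => by positivity
    _ ≤ 1 / n + 1 / n := by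
        rw [Finset.sum_range_succ']
        exact add_le_add hrest hfirst
    _ = 2 / n := by ring

lemma sum_div_sampleSize_le {a η : ℝ} {n : ℕ} (ha : 0 ≤ a) (hn : 0 < n) (h : 2 * a ≤ η * n)
    (m : ℕ) : ∑ t ∈ Finset.range m, a / sampleSize n t ≤ η := by
  have hn' : (0 : ℝ) < n := Nat.cast_pos.2 hn
  calc ∑ t ∈ Finset.range m, a / sampleSize n t
      = a * ∑ t ∈ Finset.range m, 1 / (sampleSize n t : ℝ) := by
        simp only [Finset.mul_sum, mul_one_div]
    _ ≤ a * (2 / n) := by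
        gcongr
        exact sum_one_div_sampleSize_le hn m
    _ = 2 * a / n := by ring
    _ ≤ η := (div_le_iff₀ hn').2 h

end SampleSize

section QuadraticForms

variable {d : ℕ} {M : Matrix (Fin d) (Fin d) ℝ}

lemma quad_smul (M : Matrix (Fin d) (Fin d) ℝ) (a : ℝ) (x : Vec d) :
    quad M (a • x) = a ^ 2 * quad M x := by
  simp only [quad, WithLp.ofLp_smul, Matrix.mulVec_smul, smul_dotProduct, dotProduct_smul,
    smul_eq_mul]
  ring

lemma quad_add (M M' : Matrix (Fin d) (Fin d) ℝ) (x : Vec d) :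
    quad (M + M') x = quad M x + quad M' x := by
  simp only [quad, Matrix.add_mulVec, dotProduct_add]

lemma quad_transpose_mul_mul {e : ℕ} (L : Matrix (Fin e) (Fin d) ℝ) (M : Matrix (Fin e) (Fin e) ℝ)
    (x : Vec d) : quad (Lᵀ * M * L) x = quad M (WithLp.toLp 2 (L *ᵥ x.ofLp)) := by
  simp only [quad, ← Matrix.mulVec_mulVec]
  rw [Matrix.dotProduct_mulVec, Matrix.vecMul_transpose]

lemma quad_nonneg (hM : M.PosSemidef) (x : Vec d) : 0 ≤ quad M x := by
  simpa [quad] using hM.dotProduct_mulVec_nonneg x.ofLp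

lemma quad_pos (hM : M.PosDef) {x : Vec d} (hx : x ≠ 0) : 0 < quad M x := by
  simpa [quad] using hM.dotProduct_mulVec_pos (x := x.ofLp) (by simpa)

lemma continuous_quad (M : Matrix (Fin d) (Fin d) ℝ) : Continuous (quad M) := by
  unfold quad
  fun_prop

lemma exists_pos_mul_sq_le_quad (hM : M.PosDef) : ∃ c > 0, ∀ x, c * ‖x‖ ^ 2 ≤ quad M x := by
  obtain ⟨c, hc, hsphere⟩ := (isCompact_sphere (0 : Vec d) 1).exists_forall_le'
    (continuous_quad M).continuousOn fun x hx => quad_pos hM (ne_zero_of_mem_unit_sphere ⟨x, hx⟩)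
  refine ⟨c, hc, fun x => ?_⟩
  obtain rfl | hx := eq_or_ne x 0
  · simpa using quad_nonneg hM.posSemidef 0
  have : 0 < ‖x‖ := norm_pos_iff.2 hx
  calc c * ‖x‖ ^ 2 ≤ quad M (‖x‖⁻¹ • x) * ‖x‖ ^ 2 := by
        gcongr
        exact hsphere _ (by simp [norm_smul, hx])
    _ = quad M x := by
        rw [quad_smul]
        field_simp

lemma exists_pos_forall_quad_lt_mem (hM : M.PosDef) {s : Set (Vec d)} (hs : s ∈ nhds 0) :
    ∃ a > 0, ∀ x, quad M x < a → x ∈ s := by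
  obtain ⟨c, hc, hcM⟩ := exists_pos_mul_sq_le_quad hM
  obtain ⟨r, hr, hball⟩ := Metric.mem_nhds_iff.1 hs
  refine ⟨c * r ^ 2, by positivity, fun x hx => hball ?_⟩
  have h : c * ‖x‖ ^ 2 < c * r ^ 2 := (hcM x).trans_lt hx
  rw [mem_ball_zero_iff]
  exact lt_of_pow_lt_pow_left₀ 2 hr.le (lt_of_mul_lt_mul_left h hc.le)

end QuadraticForms

section Erode

variable {d : ℕ} {s t : Set (Vec d)}

lemma isClosed_erode (hs : IsClosed s) : IsClosed (erode s t) := by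
  have : erode s t = s ∩ ⋂ y ∈ t, (fun x => x + y) ⁻¹' s := by
    ext x
    simp [erode]
  rw [this]
  exact hs.inter (isClosed_biInter fun y _ => hs.preimage (by fun_prop))

lemma mem_of_mem_erode {x y : Vec d} (hy : y ∈ erode s t) (hxy : x - y ∈ t) : x ∈ s := by
  simpa only [add_sub_cancel] using hy.2 _ hxy

end Erode

namespace MPCData

variable {dx du : ℕ} {S : MPCData dx du}

section Dynamics

lemma step_add_add (x x' : Vec dx) (u u' : Vec du) :
    S.step (x + x') (u + u') = S.step x u + S.step x' u' := by
  simp only [step, WithLp.ofLp_add, Matrix.mulVec_add, ← WithLp.toLp_add]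
  rw [add_add_add_comm]

lemma step_eq_add (x : Vec dx) (u v : Vec du) :
    S.step x u = S.step x v + WithLp.toLp 2 (S.B *ᵥ (u - v).ofLp) := by
  simp only [step, WithLp.ofLp_sub, Matrix.mulVec_sub, ← WithLp.toLp_add]
  rw [add_assoc, add_sub_cancel]

lemma continuous_lqr : Continuous S.lqr := by
  unfold lqr
  fun_prop

lemma continuous_step : Continuous fun p : Vec dx × Vec du => S.step p.1 p.2 := by
  unfold step
  fun_prop

lemma lqrTraj_add (x : Vec dx) (t s : ℕ) :
    S.lqrTraj (S.lqrTraj x t) s = S.lqrTraj x (t + s) := by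
  induction s with
  | zero => rfl
  | succ s ih =>
    rw [lqrTraj, ih]
    rfl

lemma continuous_lqrTraj (t : ℕ) : Continuous fun x => S.lqrTraj x t := by
  induction t with
  | zero => exact continuous_id
  | succ t ih => exact continuous_step.comp (ih.prodMk (continuous_lqr.comp ih))

lemma nominal_succ_eq (x : Vec dx) (u : ℕ → Vec du) (k : ℕ) :
    S.nominal x u (k + 1) = S.nominal (S.step x (u 0)) (fun j => u (j + 1)) k := by
  induction k with
  | zero => rfl
  | succ k ih =>
    rw [nominal, ih]
    rfl

lemma nominal_congr {x : Vec dx} {u v : ℕ → Vec du} {k : ℕ} (h : ∀ j < k, u j = v j) :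
    S.nominal x u k = S.nominal x v k := by
  induction k with
  | zero => rfl
  | succ k ih =>
    rw [nominal, nominal, ih fun j hj => h j (hj.trans k.lt_succ_self), h k k.lt_succ_self]

lemma nominal_lqr (x : Vec dx) (k : ℕ) :
    S.nominal x (fun j => S.lqr (S.lqrTraj x j)) k = S.lqrTraj x k := by
  induction k with
  | zero => rfl
  | succ k ih =>
    rw [nominal, ih]
    rfl

lemma continuous_nominal (k : ℕ) :
    Continuous fun p : Vec dx × (ℕ → Vec du) => S.nominal p.1 p.2 k := by
  induction k with
  | zero => exact continuous_fst
  | succ k ih => exact continuous_step.comp (ih.prodMk (by fun_prop))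

end Dynamics

section Cost

lemma continuous_cost : Continuous fun p : Vec dx × (ℕ → Vec du) => S.cost p.1 p.2 := by
  have hinput (k : ℕ) : Continuous fun p : Vec dx × (ℕ → Vec du) => p.2 k := by fun_prop
  have hquad {d : ℕ} (M : Matrix (Fin d) (Fin d) ℝ) {f : Vec dx × (ℕ → Vec du) → Vec d}
      (hf : Continuous f) : Continuous fun p => quad M (f p) := (continuous_quad M).comp hf
  exact (continuous_finsetSum _ fun k _ =>
    (hquad _ (continuous_nominal k)).add (hquad _ (hinput k))).add (hquad _ (continuous_nominal _))

lemma cost_congr {x : Vec dx} {u v : ℕ → Vec du} (h : ∀ k < S.N, u k = v k) :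
    S.cost x u = S.cost x v := by
  have hnom : ∀ k ≤ S.N, S.nominal x u k = S.nominal x v k := fun k hk =>
    nominal_congr fun j hj => h j (hj.trans_le hk)
  unfold cost
  rw [hnom _ le_rfl]
  congr 1
  refine Finset.sum_congr rfl fun k hk => ?_
  rw [Finset.mem_range] at hk
  rw [hnom k hk.le, h k hk]

lemma exists_cost_le (hU : Bornology.IsBounded S.U) (r : ℝ) :
    ∃ c, ∀ x u, ‖x‖ ≤ r → (∀ k < S.N, u k ∈ S.U) → S.cost x u ≤ c := by
  have hcompact := (isCompact_closedBall (0 : Vec dx) r).prod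
    (isCompact_univ_pi fun _ : ℕ => hU.isCompact_closure.insert 0)
  obtain ⟨c, hc⟩ := hcompact.exists_bound_of_continuousOn continuous_cost.continuousOn
  refine ⟨c, fun x u hx hu => ?_⟩
  set v : ℕ → Vec du := fun k => if k < S.N then u k else 0 with hv
  have hcost : S.cost x u = S.cost x v := cost_congr fun k hk => (if_pos hk).symm
  have hvU : ∀ k, v k ∈ insert 0 (closure S.U) := fun k => by
    simp only [hv]
    split_ifs with hk
    · exact .inr (subset_closure (hu k hk))
    · exact .inl rfl
  rw [hcost]
  exact (Real.le_norm_self _).trans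
    (hc (x, v) ⟨mem_closedBall_zero_iff.2 hx, fun k _ => hvU k⟩)

lemma quad_le_cost (hN : 1 ≤ S.N) (hQ : S.Q.PosSemidef) (hR : S.R.PosSemidef)
    (hP : S.P.PosSemidef) (x : Vec dx) (u : ℕ → Vec du) : quad S.Q x ≤ S.cost x u := by
  have hstage : ∀ k, 0 ≤ quad S.Q (S.nominal x u k) + quad S.R (u k) := fun k =>
    add_nonneg (quad_nonneg hQ _) (quad_nonneg hR _)
  calc quad S.Q x ≤ quad S.Q x + quad S.R (u 0) := le_add_of_nonneg_right (quad_nonneg hR _)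
    _ ≤ ∑ k ∈ Finset.range S.N, (quad S.Q (S.nominal x u k) + quad S.R (u k)) :=
        Finset.single_le_sum (fun k _ => hstage k) (Finset.mem_range.2 hN)
    _ ≤ S.cost x u := le_add_of_nonneg_right (quad_nonneg hP _)

end Cost

section TerminalSet

lemma mem_Obar_iff {x : Vec dx} :
    x ∈ S.Obar ↔ ∀ t, S.lqrTraj x t ∈ S.Xbar ∧ S.lqr (S.lqrTraj x t) ∈ S.Ubar := by
  constructor
  · rintro ⟨O, ⟨hOX, hO⟩, hx⟩ t
    exact ⟨hOX (hO x hx t).1, (hO x hx t).2⟩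
  · intro h
    refine ⟨{y | ∀ t, S.lqrTraj y t ∈ S.Xbar ∧ S.lqr (S.lqrTraj y t) ∈ S.Ubar},
      ⟨fun y hy => (hy 0).1, fun y hy t => ⟨fun s => ?_, (hy t).2⟩⟩, h⟩
    rw [lqrTraj_add]
    exact hy _

lemma Obar_subset_Xbar : S.Obar ⊆ S.Xbar := fun _ hx => (mem_Obar_iff.1 hx 0).1

lemma lqr_mem_Ubar {x : Vec dx} (hx : x ∈ S.Obar) : S.lqr x ∈ S.Ubar := (mem_Obar_iff.1 hx 0).2

lemma lqrTraj_mem_Obar {x : Vec dx} (hx : x ∈ S.Obar) (t : ℕ) : S.lqrTraj x t ∈ S.Obar := by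
  rw [mem_Obar_iff] at hx ⊢
  intro s
  rw [lqrTraj_add]
  exact hx _

lemma isClosed_Obar (hX : IsClosed S.X) (hU : IsClosed S.U) : IsClosed S.Obar := by
  have : S.Obar = ⋂ t, ((fun x => S.lqrTraj x t) ⁻¹' S.Xbar ∩
      (fun x => S.lqr (S.lqrTraj x t)) ⁻¹' S.Ubar) := by
    ext x
    simp [mem_Obar_iff]
  rw [this]
  exact isClosed_iInter fun t => ((isClosed_erode hX).preimage (continuous_lqrTraj t)).inter
    ((isClosed_erode hU).preimage (continuous_lqr.comp (continuous_lqrTraj t)))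

end TerminalSet

section Feasibility

lemma mem_feasibleIn_iff {k : ℕ} {x : Vec dx} :
    x ∈ S.feasibleIn k ↔ ∃ u : ℕ → Vec du,
      (∀ j < k, S.nominal x u j ∈ S.Xbar ∧ u j ∈ S.Ubar) ∧ S.nominal x u k ∈ S.Obar := by
  induction k generalizing x with
  | zero => simp [feasibleIn, nominal]
  | succ k ih =>
    constructor
    · rintro ⟨hx, u₀, hu₀, h⟩
      obtain ⟨u, hu, hO⟩ := ih.1 h
      refine ⟨fun j => Nat.casesOn j u₀ u, ?_, ?_⟩
      · rintro (_ | j) hj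
        · exact ⟨hx, hu₀⟩
        · rw [nominal_succ_eq]
          exact hu j (by omega)
      · rw [nominal_succ_eq]
        exact hO
    · rintro ⟨u, hu, hO⟩
      rw [nominal_succ_eq] at hO
      refine ⟨(hu 0 k.succ_pos).1, u 0, (hu 0 k.succ_pos).2, ih.2 ⟨_, fun j hj => ?_, hO⟩⟩
      rw [← nominal_succ_eq]
      exact hu (j + 1) (by omega)

lemma mem_feasibleDomain_iff {x : Vec dx} :
    x ∈ S.feasibleDomain ↔ ∃ u, S.MPCFeasible x u := mem_feasibleIn_iff

lemma feasibleIn_subset_Xbar (k : ℕ) : S.feasibleIn k ⊆ S.Xbar := by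
  cases k with
  | zero => exact Obar_subset_Xbar
  | succ k => exact fun x hx => hx.1

lemma feasibleDomain_subset_rmpcDomain (hE : (0 : Vec dx) ∈ S.E) :
    S.feasibleDomain ⊆ S.rmpcDomain :=
  fun x hx => ⟨(feasibleIn_subset_Xbar _ hx).1, x, hx, by rwa [sub_self]⟩

/-- The candidate solution for the next step: the input sequence `u` without its first entry,
continued by the LQR input. -/
noncomputable def shiftInputs (S : MPCData dx du) (x : Vec dx) (u : ℕ → Vec du) : ℕ → Vec du :=
  fun k => if k + 1 < S.N then u (k + 1) else S.lqr (S.nominal x u S.N)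

lemma nominal_shiftInputs {x : Vec dx} {u : ℕ → Vec du} {k : ℕ} (hk : k + 1 ≤ S.N) :
    S.nominal (S.step x (u 0)) (S.shiftInputs x u) k = S.nominal x u (k + 1) := by
  rw [nominal_succ_eq]
  refine nominal_congr fun j hj => ?_
  rw [shiftInputs, if_pos (by omega)]

lemma shiftInputs_last {x : Vec dx} {u : ℕ → Vec du} {M : ℕ} (hM : S.N = M + 1) :
    S.shiftInputs x u M = S.lqr (S.nominal x u S.N) := by
  rw [shiftInputs, if_neg (by omega)]

lemma nominal_shiftInputs_last (hN : 1 ≤ S.N) {x : Vec dx} {u : ℕ → Vec du} :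
    S.nominal (S.step x (u 0)) (S.shiftInputs x u) S.N =
      S.step (S.nominal x u S.N) (S.lqr (S.nominal x u S.N)) := by
  obtain ⟨M, hM⟩ := Nat.exists_eq_add_of_le' hN
  conv_lhs => rw [hM, nominal, shiftInputs_last hM, nominal_shiftInputs (by omega), ← hM]

lemma MPCFeasible.shift (hN : 1 ≤ S.N) {x : Vec dx} {u : ℕ → Vec du} (h : S.MPCFeasible x u) :
    S.MPCFeasible (S.step x (u 0)) (S.shiftInputs x u) := by
  refine ⟨fun k hk => ⟨?_, ?_⟩, ?_⟩
  · rw [nominal_shiftInputs hk]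
    obtain hk' | hk' := (Nat.succ_le_of_lt hk).lt_or_eq
    · exact (h.1 _ hk').1
    · rw [← Nat.succ_eq_add_one, hk']
      exact Obar_subset_Xbar h.2
  · unfold shiftInputs
    split_ifs with hk'
    · exact (h.1 _ hk').2
    · exact lqr_mem_Ubar h.2
  · rw [nominal_shiftInputs_last hN]
    exact lqrTraj_mem_Obar h.2 1

end Feasibility

section Riccati

lemma isUnit_det_riccati (hR : S.R.PosDef) (hP : S.P.PosSemidef) :
    IsUnit (S.R + S.Bᵀ * S.P * S.B).det := by
  have hBPB : (S.Bᵀ * S.P * S.B).PosSemidef := by simpa using hP.conjTranspose_mul_mul_same S.B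
  exact (Matrix.isUnit_iff_isUnit_det _).1 (hR.add_posSemidef hBPB).isUnit

lemma mul_K (hR : S.R.PosDef) (hP : S.P.PosSemidef) :
    (S.R + S.Bᵀ * S.P * S.B) * S.K = -(S.Bᵀ * S.P * S.A) := by
  rw [K, Matrix.mul_neg, Matrix.mul_assoc _ S.P S.A, Matrix.mul_assoc _ S.Bᵀ,
    Matrix.mul_nonsing_inv_cancel_left _ _ (isUnit_det_riccati hR hP), ← Matrix.mul_assoc]

lemma riccati_closedLoop (hR : S.R.PosDef) (hP : S.P.PosSemidef) (hRic : S.Riccati) :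
    S.Q + S.Kᵀ * S.R * S.K + (S.A + S.B * S.K)ᵀ * S.P * (S.A + S.B * S.K) = S.P :=
  calc S.Q + S.Kᵀ * S.R * S.K + (S.A + S.B * S.K)ᵀ * S.P * (S.A + S.B * S.K)
      = S.Aᵀ * S.P * S.A + S.Aᵀ * S.P * S.B * S.K + S.Q
        + S.Kᵀ * (S.Bᵀ * S.P * S.A + (S.R + S.Bᵀ * S.P * S.B) * S.K) := by
        simp only [Matrix.transpose_add, Matrix.transpose_mul, Matrix.add_mul, Matrix.mul_add,
          Matrix.mul_assoc]
        abel
    _ = S.Aᵀ * S.P * S.A + S.Aᵀ * S.P * S.B * S.K + S.Q := by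
        rw [mul_K hR hP, add_neg_cancel, Matrix.mul_zero, add_zero]
    _ = S.P := by
        conv_rhs => rw [hRic]
        simp only [K, Matrix.mul_neg, Matrix.mul_assoc, sub_eq_add_neg]

lemma quad_riccati (hR : S.R.PosDef) (hP : S.P.PosSemidef) (hRic : S.Riccati) (x : Vec dx) :
    quad S.Q x + quad S.R (S.lqr x) + quad S.P (S.step x (S.lqr x)) = quad S.P x := by
  have hstep : S.step x (S.lqr x) = WithLp.toLp 2 ((S.A + S.B * S.K) *ᵥ x.ofLp) := by
    simp [step, lqr, Matrix.add_mulVec, Matrix.mulVec_mulVec]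
  conv_rhs => rw [← riccati_closedLoop hR hP hRic]
  rw [quad_add, quad_add, quad_transpose_mul_mul, quad_transpose_mul_mul, hstep, lqr]

lemma cost_shiftInputs (hN : 1 ≤ S.N) (hR : S.R.PosDef) (hP : S.P.PosSemidef) (hRic : S.Riccati)
    (x : Vec dx) (u : ℕ → Vec du) :
    S.cost (S.step x (u 0)) (S.shiftInputs x u) + (quad S.Q x + quad S.R (u 0)) = S.cost x u := by
  have hlast := nominal_shiftInputs_last hN (x := x) (u := u)
  obtain ⟨M, hM⟩ := Nat.exists_eq_add_of_le' hN
  have hsum : ∑ k ∈ Finset.range M, (quad S.Q (S.nominal (S.step x (u 0)) (S.shiftInputs x u) k)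
        + quad S.R (S.shiftInputs x u k))
      = ∑ k ∈ Finset.range M, (quad S.Q (S.nominal x u (k + 1)) + quad S.R (u (k + 1))) := by
    refine Finset.sum_congr rfl fun k hk => ?_
    rw [Finset.mem_range] at hk
    rw [nominal_shiftInputs (by omega), shiftInputs, if_pos (by omega)]
  have hterminal := quad_riccati hR hP hRic (S.nominal x u (M + 1))
  unfold cost
  rw [hlast, hM, Finset.sum_range_succ, Finset.sum_range_succ' _ M, shiftInputs_last hM,
    nominal_shiftInputs (by omega), hM, hsum]
  simp only [nominal] at hterminal ⊢
  linarith

lemma cost_lqr (hR : S.R.PosDef) (hP : S.P.PosSemidef) (hRic : S.Riccati) (x : Vec dx) :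
    S.cost x (fun k => S.lqr (S.lqrTraj x k)) = quad S.P x := by
  have htelescope : ∀ m, (∑ k ∈ Finset.range m, (quad S.Q (S.lqrTraj x k)
      + quad S.R (S.lqr (S.lqrTraj x k)))) + quad S.P (S.lqrTraj x m) = quad S.P x := by
    intro m
    induction m with
    | zero => rw [Finset.sum_range_zero, zero_add, lqrTraj]
    | succ m ih => rw [Finset.sum_range_succ, ← ih, add_assoc, lqrTraj, quad_riccati hR hP hRic]
  simp only [cost, nominal_lqr]
  exact htelescope _

end Riccati

section RobustMPC

/-- A robust MPC controller whose nominal state and inputs are only required to satisfy the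
constraints of the robust MPC problem, not to be optimal. Safety depends on feasibility alone. -/
def IsFeasibleRobustMPC (S : MPCData dx du) (π : Policy dx du) : Prop :=
  ∀ x ∈ S.rmpcDomain, ∃ (x₀ : Vec dx) (u : ℕ → Vec du),
    S.RMPCFeasible x x₀ u ∧ π x = u 0 + S.lqr (x - x₀)

/-- The closed loop with `π` and disturbances of norm at most `ε` does not leave `C`. -/
def IsRobustlyInvariant (S : MPCData dx du) (π : Policy dx du) (C : Set (Vec dx)) : Prop :=
  ∀ x ∈ C, ∀ w : Vec dx, ‖w‖ ≤ S.ε → S.step x (π x) + w ∈ C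

variable {x x₀ w : Vec dx} {u : ℕ → Vec du} {π : Policy dx du}

lemma IsDisturbanceInvariant.zero_mem (hE : S.IsDisturbanceInvariant) : (0 : Vec dx) ∈ S.E :=
  mem_of_mem_nhds hE.1

lemma IsRobustMPC.isFeasibleRobustMPC (hπ : S.IsRobustMPC π) : S.IsFeasibleRobustMPC π :=
  fun x hx => let ⟨x₀, u, hopt, h⟩ := hπ x hx; ⟨x₀, u, hopt.1, h⟩

lemma RMPCFeasible.shift (hN : 1 ≤ S.N) (hE : S.IsDisturbanceInvariant)
    (h : S.RMPCFeasible x x₀ u) (hw : ‖w‖ ≤ S.ε) :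
    S.RMPCFeasible (S.step x (u 0 + S.lqr (x - x₀)) + w) (S.step x₀ (u 0))
      (S.shiftInputs x₀ u) := by
  refine ⟨h.1.shift hN, ?_⟩
  have hstep : S.step x (u 0 + S.lqr (x - x₀)) =
      S.step x₀ (u 0) + S.step (x - x₀) (S.lqr (x - x₀)) := by
    rw [← step_add_add, add_sub_cancel]
  rw [hstep, add_assoc, add_sub_cancel_left]
  exact hE.2 _ h.2 w (mem_closedBall_zero_iff.2 hw)

lemma RMPCFeasible.mem_rmpcDomain (h : S.RMPCFeasible x x₀ u) : x ∈ S.rmpcDomain :=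
  have hx₀ : x₀ ∈ S.feasibleDomain := mem_feasibleDomain_iff.2 ⟨u, h.1⟩
  ⟨mem_of_mem_erode (feasibleIn_subset_Xbar _ hx₀) h.2, x₀, hx₀, h.2⟩

lemma IsFeasibleRobustMPC.isRobustlyInvariant_rmpcDomain (hN : 1 ≤ S.N)
    (hE : S.IsDisturbanceInvariant) (hπ : S.IsFeasibleRobustMPC π) :
    S.IsRobustlyInvariant π S.rmpcDomain := by
  intro x hx w hw
  obtain ⟨x₀, u, hfeas, hπx⟩ := hπ x hx
  rw [hπx]
  exact (hfeas.shift hN hE hw).mem_rmpcDomain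

lemma IsRobustlyInvariant.disturbedTraj_mem {C : Set (Vec dx)} (hC : S.IsRobustlyInvariant π C)
    (hx₀ : x₀ ∈ C) {w : ℕ → Vec dx} (hw : ∀ t, ‖w t‖ ≤ S.ε) (t : ℕ) :
    S.disturbedTraj π w x₀ t ∈ C := by
  induction t with
  | zero => exact hx₀
  | succ t ih => exact hC _ ih _ (hw t)

lemma RMPCOptimal.cost_add_le (hN : 1 ≤ S.N) (hE : S.IsDisturbanceInvariant) (hR : S.R.PosDef)
    (hP : S.P.PosSemidef) (hRic : S.Riccati) (h : S.RMPCOptimal x x₀ u) (hw : ‖w‖ ≤ S.ε)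
    {x₀' : Vec dx} {u' : ℕ → Vec du}
    (h' : S.RMPCOptimal (S.step x (u 0 + S.lqr (x - x₀)) + w) x₀' u') :
    S.cost x₀' u' + quad S.Q x₀ ≤ S.cost x₀ u := by
  have hopt := h'.2 _ _ (h.1.shift hN hE hw)
  have hshift := cost_shiftInputs hN hR hP hRic x₀ u
  linarith [quad_nonneg hR.posSemidef (u 0)]

lemma RMPCOptimal.cost_le_quad (hR : S.R.PosDef) (hP : S.P.PosSemidef) (hRic : S.Riccati)
    (h : S.RMPCOptimal x x₀ u) (hx₀ : x₀ ∈ S.Obar) : S.cost x₀ u ≤ quad S.P x₀ := by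
  rw [← cost_lqr hR hP hRic]
  refine h.2 _ _ ⟨⟨fun k _ => ?_, ?_⟩, h.1.2⟩
  · rw [nominal_lqr]
    exact mem_Obar_iff.1 hx₀ k
  · rw [nominal_lqr]
    exact lqrTraj_mem_Obar hx₀ _

lemma RMPCOptimal.exists_forall_cost_le (hE : (0 : Vec dx) ∈ S.E) (hU : Bornology.IsBounded S.U)
    (r : ℝ) : ∃ c, ∀ x ∈ S.feasibleDomain, ‖x‖ ≤ r → ∀ x₀ u, S.RMPCOptimal x x₀ u →
      S.cost x₀ u ≤ c := by
  obtain ⟨c, hc⟩ := exists_cost_le hU r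
  refine ⟨c, fun x hx hxr x₀ u h => ?_⟩
  obtain ⟨v, hv⟩ := mem_feasibleDomain_iff.1 hx
  exact (h.2 x v ⟨hv, by rwa [sub_self]⟩).trans (hc x v hxr fun k hk => (hv.1 k hk).2.1)

/-- The optimal cost is a Lyapunov function of the nominal state. Once that state has `Q`-norm
below `b` it is in the terminal set and the optimal cost is below `a`, which keeps the later
nominal states in the eroded terminal set. -/
lemma IsRobustMPC.exists_forall_disturbedTraj_mem_Obar (hN : 1 ≤ S.N)
    (hU : Bornology.IsBounded S.U) (hE : S.IsDisturbanceInvariant) (hQ : S.Q.PosDef)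
    (hR : S.R.PosDef) (hP : S.P.PosSemidef) (hRic : S.Riccati) (hπ : S.IsRobustMPC π)
    (h0 : (0 : Vec dx) ∈ interior (erode S.Obar S.E)) (r : ℝ) :
    ∃ τ ≥ 1, ∀ x₀ ∈ S.feasibleDomain, ‖x₀‖ ≤ r → ∀ w : ℕ → Vec dx, (∀ t, ‖w t‖ ≤ S.ε) →
      S.disturbedTraj π w x₀ τ ∈ S.Obar := by
  obtain ⟨a, ha, hQa⟩ := exists_pos_forall_quad_lt_mem hQ (mem_interior_iff_mem_nhds.1 h0)
  have hPa : {x | quad S.P x < a} ∈ nhds 0 :=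
    (continuous_quad S.P).continuousAt.eventually_lt_const (by simpa [quad] using ha)
  obtain ⟨b, hb, hQb⟩ := exists_pos_forall_quad_lt_mem hQ
    (Filter.inter_mem (mem_interior_iff_mem_nhds.1 h0) hPa)
  obtain ⟨c, hc⟩ := RMPCOptimal.exists_forall_cost_le hE.zero_mem hU r
  obtain ⟨m, hm⟩ := exists_nat_gt (c / b)
  have hmb : c < (m + 1 : ℕ) * b := by
    rw [div_lt_iff₀ hb] at hm
    push_cast
    linarith
  refine ⟨m + 1, m.succ_pos, fun x₀ hx₀ hx₀r w hw => ?_⟩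
  have hdom := (hπ.isFeasibleRobustMPC.isRobustlyInvariant_rmpcDomain hN hE).disturbedTraj_mem
    (feasibleDomain_subset_rmpcDomain hE.zero_mem hx₀) hw
  choose z u hopt hinput using fun t => hπ _ (hdom t)
  have hQ_le : ∀ t, quad S.Q (z t) ≤ S.cost (z t) (u t) := fun t =>
    quad_le_cost hN hQ.posSemidef hR.posSemidef hP _ _
  have hdec : ∀ t, S.cost (z (t + 1)) (u (t + 1)) + quad S.Q (z t) ≤ S.cost (z t) (u t) := by
    refine fun t => (hopt t).cost_add_le hN hE hR hP hRic (hw t) ?_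
    rw [← hinput t]
    exact hopt (t + 1)
  have hsmall : ∀ t, quad S.Q (z t) < b → S.cost (z t) (u t) < a := fun t ht =>
    ((hopt t).cost_le_quad hR hP hRic (hQb _ ht).1.1).trans_lt (hQb _ ht).2
  have hlast : S.cost (z (m + 1)) (u (m + 1)) < a :=
    lt_of_add_le (fun t => quad_nonneg hQ.posSemidef _) hQ_le hdec hsmall
      ((hc _ hx₀ hx₀r _ _ (hopt 0)).trans_lt hmb)
  exact mem_of_mem_erode (hQa _ ((hQ_le _).trans_lt hlast)) (hopt (m + 1)).1.2

end RobustMPC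

end MPCData

namespace MPCData

variable {dx du : ℕ} {S : MPCData dx du} {expert : Policy dx du} {π : ℕ → Policy dx du}

section Trajectories

/-- Along the trajectory of `π` from `x₀`, the inputs are within `ε / ‖B‖` of the expert's before
time `τ`. Written as a product so that `B = 0` imposes no condition. -/
def IsCloseUntil (S : MPCData dx du) (expert : Policy dx du) (π : ℕ → Policy dx du) (τ : ℕ)
    (x₀ : Vec dx) : Prop :=
  ∀ t < τ, ‖S.B‖ * ‖expert (S.traj π x₀ t) - π t (S.traj π x₀ t)‖ ≤ S.ε

/-- The initial states from which the trajectory of `π` is in the terminal set at time `τ`. -/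
def reachSet (S : MPCData dx du) (π : ℕ → Policy dx du) (τ : ℕ) : Set (Vec dx) :=
  {x₀ | S.traj π x₀ τ ∈ S.Obar}

/-- The initial states from which `p` and the expert choose different inputs at time `t`, after
`π` has been followed up to then. -/
def disagreement (S : MPCData dx du) (expert : Policy dx du) (π : ℕ → Policy dx du) (t : ℕ)
    (p : Policy dx du) : Set (Vec dx) :=
  {x₀ | p (S.traj π x₀ t) ≠ expert (S.traj π x₀ t)}

variable {C : Set (Vec dx)} {x₀ : Vec dx} {t τ : ℕ}

lemma dependsOn_traj (x₀ : Vec dx) (t : ℕ) :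
    DependsOn (fun π => S.traj π x₀ t) (Finset.range t) := by
  intro π π' h
  induction t with
  | zero => rfl
  | succ t ih =>
    have hprev := ih fun s hs => h s (Finset.range_mono t.le_succ hs)
    simp only [traj, hprev, h t (Finset.self_mem_range_succ t)]

lemma dependsOn_reachSet (τ : ℕ) : DependsOn (fun π => S.reachSet π τ) (Finset.range τ) :=
  fun _ _ h => Set.ext fun x => by simp only [reachSet, dependsOn_traj x τ h, Set.mem_ofPred_eq]

lemma dependsOn_disagreement (expert : Policy dx du) (t : ℕ) :
    DependsOn (fun π => S.disagreement expert π t) (Finset.range t) :=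
  fun _ _ h => funext fun p => Set.ext fun x => by
    simp only [disagreement, dependsOn_traj x t h, Set.mem_ofPred_eq]

lemma measurable_traj (hπ : ∀ s, Measurable (π s)) (t : ℕ) :
    Measurable fun x => S.traj π x t := by
  induction t with
  | zero => exact measurable_id
  | succ t ih => exact continuous_step.measurable.comp (ih.prodMk ((hπ t).comp ih))

lemma measurableSet_reachSet (hO : MeasurableSet S.Obar) (hπ : ∀ s, Measurable (π s)) (τ : ℕ) :
    MeasurableSet (S.reachSet π τ) := measurable_traj hπ τ hO

lemma measurableSet_disagreement (hexpert : Measurable expert) (hπ : ∀ s, Measurable (π s))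
    (t : ℕ) {p : Policy dx du} (hp : Measurable p) :
    MeasurableSet (S.disagreement expert π t p) :=
  (measurableSet_eq_fun (hp.comp (measurable_traj hπ t))
    (hexpert.comp (measurable_traj hπ t))).compl

lemma norm_le_inputBound (hU : Bornology.IsBounded S.U) {u : Vec du} (hu : u ∈ S.U) :
    ‖u‖ ≤ S.inputBound := by
  obtain ⟨b, hb⟩ := hU.exists_norm_le
  refine le_csSup ⟨b, ?_⟩ ⟨u, hu, rfl⟩
  rintro _ ⟨v, hv, rfl⟩
  exact hb v hv

/-- The disturbance at time `t` is `B` times the deviation from the expert's input. -/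
lemma IsCloseUntil.exists_disturbedTraj_eq (hε : 0 ≤ S.ε) (h : S.IsCloseUntil expert π τ x₀) :
    ∃ w : ℕ → Vec dx, (∀ t, ‖w t‖ ≤ S.ε) ∧
      ∀ t ≤ τ, S.disturbedTraj expert w x₀ t = S.traj π x₀ t := by
  let deviation (t : ℕ) : Vec du := π t (S.traj π x₀ t) - expert (S.traj π x₀ t)
  refine ⟨fun t => if t < τ then WithLp.toLp 2 (S.B *ᵥ (deviation t).ofLp) else 0,
    fun t => ?_, fun t ht => ?_⟩
  · dsimp only
    split_ifs with ht
    · refine (S.B.l2_opNorm_mulVec _).trans ?_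
      rw [norm_sub_rev]
      exact h t ht
    · rwa [norm_zero]
  · induction t with
    | zero => rfl
    | succ t ih => rw [disturbedTraj, ih (by omega), if_pos (by omega), ← step_eq_add, traj]

lemma IsRobustlyInvariant.traj_mem (hC : S.IsRobustlyInvariant expert C) (hε : 0 ≤ S.ε)
    (hx₀ : x₀ ∈ C) (h : S.IsCloseUntil expert π τ x₀) (ht : t ≤ τ) : S.traj π x₀ t ∈ C := by
  obtain ⟨w, hw, heq⟩ := h.exists_disturbedTraj_eq hε
  rw [← heq t ht]
  exact hC.disturbedTraj_mem hx₀ hw t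

lemma IsRobustlyInvariant.isCloseUntil_of_two_mul_inputBound_le
    (hC : S.IsRobustlyInvariant expert C) (hCX : C ⊆ S.X) (hε : 0 ≤ S.ε)
    (hU : Bornology.IsBounded S.U) (hsmall : 2 * (‖S.B‖ * S.inputBound) ≤ S.ε)
    (hexpert : ∀ x ∈ S.X, expert x ∈ S.U) (hπ : ∀ t, ∀ x ∈ S.X, π t x ∈ S.U) (hx₀ : x₀ ∈ C)
    (τ : ℕ) : S.IsCloseUntil expert π τ x₀ := by
  intro t _
  induction t using Nat.strong_induction_on with
  | _ t ih =>
    have hX := hCX (hC.traj_mem hε hx₀ (fun s hs => ih s hs (by omega)) le_rfl)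
    calc ‖S.B‖ * ‖expert (S.traj π x₀ t) - π t (S.traj π x₀ t)‖
        ≤ ‖S.B‖ * (S.inputBound + S.inputBound) := by
          gcongr
          exact norm_sub_le_of_le (norm_le_inputBound hU (hexpert _ hX))
            (norm_le_inputBound hU (hπ t _ hX))
      _ = 2 * (‖S.B‖ * S.inputBound) := by ring
      _ ≤ S.ε := hsmall

end Trajectories

section ReachTime

variable {D : Measure (Vec dx)}

lemma tauStar_ne_top (hN : 1 ≤ S.N) (hU : Bornology.IsBounded S.U)
    (hE : S.IsDisturbanceInvariant) (hQ : S.Q.PosDef) (hR : S.R.PosDef) (hP : S.P.PosSemidef)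
    (hRic : S.Riccati) (hexpert : S.IsRobustMPC expert)
    (h0 : (0 : Vec dx) ∈ interior (erode S.Obar S.E)) (hD_feas : ∀ᵐ x ∂D, x ∈ S.feasibleDomain)
    (hD_bdd : ∃ r : ℝ, ∀ᵐ x ∂D, ‖x‖ ≤ r) : S.tauStar D expert ≠ ⊤ := by
  obtain ⟨r, hr⟩ := hD_bdd
  obtain ⟨τ, hτ1, hτ⟩ :=
    hexpert.exists_forall_disturbedTraj_mem_Obar hN hU hE hQ hR hP hRic h0 r
  have hmem : τ ∈ S.reachTimes D expert := by
    refine ⟨hτ1, ?_⟩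
    filter_upwards [hD_feas, hr] with x hx hxr using hτ x hx hxr
  exact ne_top_of_le_ne_top (ENat.natCast_ne_top τ) (iInf₂_le τ hmem)

lemma exists_tauStar_eq (h : S.tauStar D expert ≠ ⊤) :
    ∃ t : ℕ, S.tauStar D expert = (t + 1 : ℕ) ∧ t + 1 ∈ S.reachTimes D expert := by
  have hne : (S.reachTimes D expert).Nonempty := by
    by_contra! hempty
    simp [tauStar, hempty] at h
  have hmem := Nat.sInf_mem hne
  refine ⟨sInf (S.reachTimes D expert) - 1, ?_, ?_⟩
  · rw [Nat.sub_add_cancel hmem.1]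
    exact le_antisymm (iInf₂_le _ hmem) (le_iInf₂ fun _ hτ => Nat.cast_le.2 (Nat.sInf_le hτ))
  · rwa [Nat.sub_add_cancel hmem.1]

lemma measureReal_reachSet_compl_le [IsFiniteMeasure D] (hε : 0 ≤ S.ε) {τ τ' : ℕ}
    (hτ : τ ∈ S.reachTimes D expert) (hle : τ ≤ τ') (π : ℕ → Policy dx du) :
    D.real (S.reachSet π τ)ᶜ ≤ D.real {x₀ | S.IsCloseUntil expert π τ' x₀}ᶜ := by
  refine ENNReal.toReal_mono (measure_ne_top _ _) (measure_mono_ae ?_)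
  filter_upwards [hτ.2] with x₀ hx₀ hmiss hclose
  obtain ⟨w, hw, heq⟩ := IsCloseUntil.exists_disturbedTraj_eq hε hclose
  refine hmiss ?_
  rw [reachSet, Set.mem_ofPred_eq, ← heq τ hle]
  exact hx₀ w hw

end ReachTime

section SwitchTime

variable {T ℓ τ : ℕ} {v : ℕ → Fin ℓ → Vec dx} {x₀ : Vec dx}

lemma switchTime_le : S.switchTime T ℓ π v ≤ T := Nat.sInf_le (.inr rfl)

lemma switchTime_le_succ {t : ℕ} (h : ∀ i, v t i ∈ S.reachSet π (t + 1)) :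
    S.switchTime T ℓ π v ≤ t + 1 := Nat.sInf_le (.inl ⟨t, rfl, h⟩)

lemma exists_of_switchTime_lt (h : S.switchTime T ℓ π v < T) :
    ∃ t, S.switchTime T ℓ π v = t + 1 ∧ ∀ i, v t i ∈ S.reachSet π (t + 1) := by
  have hmem : S.switchTime T ℓ π v ∈
      ({τ | ∃ t, τ = t + 1 ∧ ∀ i, S.traj π (v t i) (t + 1) ∈ S.Obar} ∪ {T} : Set ℕ) :=
    Nat.sInf_mem ⟨T, .inr rfl⟩
  exact hmem.resolve_right h.ne

lemma traj_switched_eq (x₀ : Vec dx) {t : ℕ} (ht : t ≤ τ) :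
    S.traj (S.switched π τ) x₀ t = S.traj π x₀ t :=
  dependsOn_traj x₀ t fun _ hs => if_pos ((Finset.mem_range.1 hs).trans_le ht)

lemma switched_add (k : ℕ) : S.switched π τ (τ + k) = S.lqr := if_neg (by omega)

lemma traj_switched_mem_Obar (h : x₀ ∈ S.reachSet π τ) (k : ℕ) :
    S.traj (S.switched π τ) x₀ (τ + k) ∈ S.Obar := by
  induction k with
  | zero => rwa [add_zero, traj_switched_eq x₀ le_rfl]
  | succ k ih =>
    rw [← add_assoc, traj, switched_add]
    exact lqrTraj_mem_Obar ih 1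

lemma IsRobustlyInvariant.switched_safe {C : Set (Vec dx)}
    (hC : S.IsRobustlyInvariant expert C) (hCX : C ⊆ S.X) (hε : 0 ≤ S.ε)
    (hπ : ∀ t, ∀ x ∈ S.X, π t x ∈ S.U) (hx₀ : x₀ ∈ C) (hreach : x₀ ∈ S.reachSet π τ)
    (hclose : S.IsCloseUntil expert π τ x₀) (t : ℕ) :
    S.traj (S.switched π τ) x₀ t ∈ S.X ∧
      S.switched π τ t (S.traj (S.switched π τ) x₀ t) ∈ S.U := by
  obtain ht | ht := lt_or_ge t τ
  · have hX := hCX (hC.traj_mem hε hx₀ hclose ht.le)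
    rw [traj_switched_eq x₀ ht.le, switched, if_pos ht]
    exact ⟨hX, hπ t _ hX⟩
  · obtain ⟨k, rfl⟩ := Nat.exists_eq_add_of_le ht
    have hO := traj_switched_mem_Obar hreach k
    rw [switched_add]
    exact ⟨(Obar_subset_Xbar hO).1, (lqr_mem_Ubar hO).1⟩

end SwitchTime

end MPCData

namespace ForwardSwitch

variable {dx du : ℕ} {S : MPCData dx du} {D : Measure (Vec dx)} {Pol : Finset (Policy dx du)}
  {expert : Policy dx du} {n T ℓ : ℕ} {Ω : Type*} [mΩ : MeasurableSpace Ω] {μ : Measure Ω}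
  (F : ForwardSwitch S D Pol expert n T ℓ μ)

/-- Some policy of the class agrees with the expert on the whole training sample of stage `t`,
although a fresh trajectory makes them disagree with probability more than `η`. -/
def misleadingTrain (t : ℕ) (η : ℝ) : Set Ω :=
  {ω | ∃ p ∈ Pol, η < D.real (S.disagreement expert (F.learned ω) t p) ∧
    ∀ i, F.train t ω i ∈ (S.disagreement expert (F.learned ω) t p)ᶜ}

/-- The test of stage `t` is passed, although the terminal set is reached at time `t + 1` with
probability less than `1 - δ`. -/
def falsePass (t : ℕ) (δ : ℝ) : Set Ω :=
  {ω | D.real (S.reachSet (F.learned ω) (t + 1)) < 1 - δ ∧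
    ∀ i, F.test t ω i ∈ S.reachSet (F.learned ω) (t + 1)}

/-- The test of stage `t` is failed, although the terminal set is missed at time `t + 1` with
probability at most `β`. -/
def falseFail (t : ℕ) (β : ℝ) : Set Ω :=
  {ω | D.real (S.reachSet (F.learned ω) (t + 1))ᶜ ≤ β ∧
    ∃ i, F.test t ω i ∈ (S.reachSet (F.learned ω) (t + 1))ᶜ}

section Sampling

lemma before_le (t : ℕ) : F.before t ≤ mΩ := (F.before_le_after t).trans (F.after_le t)

lemma after_mono : Monotone F.after :=
  monotone_nat_of_le_succ fun t => (F.after_le_before t).trans (F.before_le_after _)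

lemma after_le_before_of_lt {s t : ℕ} (h : s < t) : F.after s ≤ F.before t := by
  obtain ⟨k, rfl⟩ := Nat.exists_eq_add_of_lt h
  exact (F.after_mono (Nat.le_add_right s k)).trans (F.after_le_before _)

variable [IsProbabilityMeasure μ]

lemma measureReal_train_mem_le (t : ℕ)
    {b : (ℕ → Policy dx du) → Set (Fin (sampleSize n t) → Vec dx)}
    (hdep : DependsOn b (Finset.range t)) (hb : ∀ π, (∀ s, π s ∈ Pol) → MeasurableSet (b π))
    {β : ℝ} (hβ : ∀ π, (∀ s, π s ∈ Pol) → (Measure.pi fun _ => D).real (b π) ≤ β) :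
    μ.real {ω | F.train t ω ∈ b (F.learned ω)} ≤ β :=
  measureReal_mem_le_of_indep_of_dependsOn ((F.train_meas t).mono (F.after_le t) le_rfl)
    (F.before_le t) (F.train_indep t) (fun ω s => F.policy_mem s ω)
    (fun s hs p hp => F.after_le_before_of_lt (Finset.mem_range.1 hs) _ (F.policy_meas s p hp))
    hdep hb (by rwa [F.train_law])

lemma measureReal_test_mem_le (t : ℕ) {b : (ℕ → Policy dx du) → Set (Fin ℓ → Vec dx)}
    (hdep : DependsOn b (Finset.range (t + 1)))
    (hb : ∀ π, (∀ s, π s ∈ Pol) → MeasurableSet (b π))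
    {β : ℝ} (hβ : ∀ π, (∀ s, π s ∈ Pol) → (Measure.pi fun _ => D).real (b π) ≤ β) :
    μ.real {ω | F.test t ω ∈ b (F.learned ω)} ≤ β :=
  measureReal_mem_le_of_indep_of_dependsOn ((F.test_meas t).mono (F.before_le _) le_rfl)
    (F.after_le t) (F.test_indep t) (fun ω s => F.policy_mem s ω)
    (fun s hs p hp => F.after_mono (Finset.mem_range_succ_iff.1 hs) _ (F.policy_meas s p hp))
    hdep hb (by rwa [F.test_law])

variable [IsProbabilityMeasure D]

lemma measureReal_misleadingTrain_le (hexpert : expert ∈ Pol)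
    (hPol : ∀ p ∈ Pol, Measurable p) (t : ℕ) (η : ℝ) :
    μ.real (F.misleadingTrain t η) ≤ Pol.card * Real.exp (-(η * sampleSize n t)) := by
  have hunion : F.misleadingTrain t η =
      ⋃ p ∈ Pol, {ω | η < D.real (S.disagreement expert (F.learned ω) t p) ∧
        ∀ i, F.train t ω i ∈ (S.disagreement expert (F.learned ω) t p)ᶜ} := by
    ext ω
    simp only [misleadingTrain, Set.mem_ofPred_eq, Set.mem_iUnion, exists_prop]
  have hmeas (π : ℕ → Policy dx du) (hπ : ∀ s, π s ∈ Pol) (p : Policy dx du) (hp : p ∈ Pol) :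
      MeasurableSet (S.disagreement expert π t p) :=
    MPCData.measurableSet_disagreement (hPol _ hexpert) (fun s => hPol _ (hπ s)) t (hPol p hp)
  rw [hunion]
  refine measureReal_biUnion_finset_le_card_mul Pol fun p hp =>
    F.measureReal_train_mem_le t
      (b := fun π => {x | η < D.real (S.disagreement expert π t p) ∧
        ∀ i, x i ∈ (S.disagreement expert π t p)ᶜ})
      (fun _ _ h => by simp only [MPCData.dependsOn_disagreement expert t h])
      (fun π hπ => (MeasurableSet.const _).inter (measurableSet_forall_mem (hmeas π hπ p hp).compl))
      fun π hπ => measureReal_and_mem_le (by positivity) fun hη => ?_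
  have hagree : D.real (S.disagreement expert π t p)ᶜ ≤ 1 - η := by
    rw [probReal_compl_eq_one_sub (hmeas π hπ p hp)]
    linarith
  exact (measureReal_pi_forall_mem_le hagree).trans_eq (by rw [Fintype.card_fin])

lemma measureReal_falsePass_le (hO : MeasurableSet S.Obar) (hPol : ∀ p ∈ Pol, Measurable p)
    (t : ℕ) (δ : ℝ) : μ.real (F.falsePass t δ) ≤ Real.exp (-(δ * ℓ)) := by
  refine F.measureReal_test_mem_le t
    (b := fun π => {x | D.real (S.reachSet π (t + 1)) < 1 - δ ∧
      ∀ i, x i ∈ S.reachSet π (t + 1)})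
    (fun _ _ h => by simp only [MPCData.dependsOn_reachSet (t + 1) h])
    (fun π hπ => (MeasurableSet.const _).inter (measurableSet_forall_mem
      (MPCData.measurableSet_reachSet hO (fun s => hPol _ (hπ s)) _)))
    fun π _ => measureReal_and_mem_le (by positivity) fun hlt => ?_
  exact (measureReal_pi_forall_mem_le hlt.le).trans_eq (by rw [Fintype.card_fin])

lemma measureReal_falseFail_le (hO : MeasurableSet S.Obar) (hPol : ∀ p ∈ Pol, Measurable p)
    (t : ℕ) {β : ℝ} (hβ : 0 ≤ β) : μ.real (F.falseFail t β) ≤ ℓ * β := by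
  have hmeas (π : ℕ → Policy dx du) (hπ : ∀ s, π s ∈ Pol) :
      MeasurableSet (S.reachSet π (t + 1))ᶜ :=
    (MPCData.measurableSet_reachSet hO (fun s => hPol _ (hπ s)) _).compl
  refine F.measureReal_test_mem_le t
    (b := fun π => {x | D.real (S.reachSet π (t + 1))ᶜ ≤ β ∧
      ∃ i, x i ∈ (S.reachSet π (t + 1))ᶜ})
    (fun _ _ h => by simp only [MPCData.dependsOn_reachSet (t + 1) h])
    (fun π hπ => (MeasurableSet.const _).inter (measurableSet_exists_mem (hmeas π hπ)))
    fun π hπ => measureReal_and_mem_le (by positivity) fun hle => ?_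
  refine (measureReal_pi_exists_mem_le (hmeas π hπ)).trans ?_
  rw [Fintype.card_fin]
  gcongr

lemma measureReal_biUnion_misleadingTrain_le (hexpert : expert ∈ Pol)
    (hPol : ∀ p ∈ Pol, Measurable p) (hn : 0 < n) {a : ℝ} (ha : 0 < a) :
    μ.real (⋃ t ∈ Finset.range T, F.misleadingTrain t (Real.log a / sampleSize n t)) ≤
      T * (Pol.card / a) := by
  refine (measureReal_biUnion_finset_le_card_mul _ fun t _ => ?_).trans_eq
    (by rw [Finset.card_range])
  have hm : (sampleSize n t : ℝ) ≠ 0 := Nat.cast_ne_zero.2 (hn.trans_le (le_sampleSize n t)).ne'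
  refine (F.measureReal_misleadingTrain_le hexpert hPol t _).trans_eq ?_
  rw [div_mul_cancel₀ _ hm, Real.exp_neg, Real.exp_log ha, div_eq_mul_inv]

lemma measureReal_biUnion_falsePass_le (hO : MeasurableSet S.Obar)
    (hPol : ∀ p ∈ Pol, Measurable p) (hT : 1 ≤ T) {δ : ℝ} (hδ : 0 < δ)
    (hl : Real.log (T / δ) ≤ δ * ℓ) :
    μ.real (⋃ t ∈ Finset.range T, F.falsePass t δ) ≤ δ := by
  have hT' : (0 : ℝ) < T := Nat.cast_pos.2 hT
  calc μ.real (⋃ t ∈ Finset.range T, F.falsePass t δ)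
      ≤ (Finset.range T).card * Real.exp (-(δ * ℓ)) :=
        measureReal_biUnion_finset_le_card_mul _ fun t _ => F.measureReal_falsePass_le hO hPol t δ
    _ ≤ T * Real.exp (-Real.log (T / δ)) := by
        rw [Finset.card_range]
        gcongr
    _ = δ := by
        rw [Real.exp_neg, Real.exp_log (by positivity), inv_div, mul_div_cancel₀ _ hT'.ne']

end Sampling

section Imitation

variable {ω : Ω}

/-- The expert belongs to the class and has zero empirical loss, hence so has the minimizer. -/
lemma train_mem_disagreement_compl (hexpert : expert ∈ Pol) {t : ℕ} (ht : t < F.tauHat ω)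
    (i : Fin (sampleSize n t)) :
    F.train t ω i ∈ (S.disagreement expert (F.learned ω) t (F.policy t ω))ᶜ := by
  have hm : (0 : ℝ) < sampleSize n t := Nat.cast_pos.2 i.pos
  have herm := F.erm t ω ht expert hexpert
  simp only [MPCData.empLoss, sub_self, norm_zero, Finset.sum_const_zero, mul_zero] at herm
  have hsum := le_antisymm (nonpos_of_mul_nonpos_right herm (one_div_pos.2 hm))
    (Finset.sum_nonneg fun _ _ => norm_nonneg _)
  have hzero := (Finset.sum_eq_zero_iff_of_nonneg fun _ _ => norm_nonneg _).1 hsum i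
    (Finset.mem_univ i)
  exact not_not.2 (sub_eq_zero.1 (norm_eq_zero.1 hzero)).symm

lemma closeEvent_compl_subset (hε : 0 ≤ S.ε) :
    (F.closeEvent ω)ᶜ ⊆
      ⋃ t ∈ Finset.range (F.tauHat ω), S.disagreement expert (F.learned ω) t (F.policy t ω) := by
  intro x hx
  simp only [closeEvent, Set.mem_compl_iff, Set.mem_ofPred_eq, not_forall] at hx
  obtain ⟨t, ht, hfar⟩ := hx
  refine Set.mem_biUnion (Finset.mem_coe.2 (Finset.mem_range.2 ht)) fun heq => hfar ?_
  rwa [learned, heq, sub_self, norm_zero, mul_zero]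

variable [IsProbabilityMeasure D]

lemma measureReal_closeEvent_compl_le (hε : 0 ≤ S.ε) (hexpert : expert ∈ Pol) {η : ℕ → ℝ}
    (hω : ω ∉ ⋃ t ∈ Finset.range T, F.misleadingTrain t (η t)) :
    D.real (F.closeEvent ω)ᶜ ≤ ∑ t ∈ Finset.range (F.tauHat ω), η t := by
  have hdis (t : ℕ) (ht : t ∈ Finset.range (F.tauHat ω)) :
      D.real (S.disagreement expert (F.learned ω) t (F.policy t ω)) ≤ η t := by
    by_contra! hlt
    rw [Finset.mem_range] at ht
    exact hω (Set.mem_biUnion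
      (Finset.mem_coe.2 (Finset.mem_range.2 (ht.trans_le MPCData.switchTime_le)))
      ⟨_, F.policy_mem t ω, hlt, F.train_mem_disagreement_compl hexpert ht⟩)
  calc D.real (F.closeEvent ω)ᶜ
      ≤ D.real (⋃ t ∈ Finset.range (F.tauHat ω),
          S.disagreement expert (F.learned ω) t (F.policy t ω)) :=
        measureReal_mono (F.closeEvent_compl_subset hε) (measure_ne_top _ _)
    _ ≤ ∑ t ∈ Finset.range (F.tauHat ω),
          D.real (S.disagreement expert (F.learned ω) t (F.policy t ω)) :=
        measureReal_biUnion_finset_le _ _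
    _ ≤ ∑ t ∈ Finset.range (F.tauHat ω), η t := Finset.sum_le_sum hdis

lemma measureReal_closeEvent_compl_eq_zero {C : Set (Vec dx)}
    (hC : S.IsRobustlyInvariant expert C) (hCX : C ⊆ S.X) (hDC : ∀ᵐ x ∂D, x ∈ C) (hε : 0 ≤ S.ε)
    (hU : Bornology.IsBounded S.U) (hsmall : 2 * (‖S.B‖ * S.inputBound) ≤ S.ε)
    (hexpert : expert ∈ Pol) (hPol : ∀ p ∈ Pol, ∀ x ∈ S.X, p x ∈ S.U) :
    D.real (F.closeEvent ω)ᶜ = 0 := by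
  rw [measureReal_eq_zero_iff]
  refine measure_mono_null (Set.compl_subset_compl.2 fun x hx => ?_) hDC
  exact hC.isCloseUntil_of_two_mul_inputBound_le hCX hε hU hsmall (hPol _ hexpert)
    (fun t => hPol _ (F.policy_mem t ω)) hx _

end Imitation

lemma exists_measureReal_closeEvent_compl_le [IsProbabilityMeasure D] [IsProbabilityMeasure μ]
    {C : Set (Vec dx)} (hC : S.IsRobustlyInvariant expert C) (hCX : C ⊆ S.X)
    (hDC : ∀ᵐ x ∂D, x ∈ C) (hε : 0 < S.ε) (hU : Bornology.IsBounded S.U) {δ : ℝ} (hδ0 : 0 < δ)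
    (hδ1 : δ < 1) (hexpert : expert ∈ Pol) (hPol_meas : ∀ p ∈ Pol, Measurable p)
    (hPol_input : ∀ p ∈ Pol, ∀ x ∈ S.X, p x ∈ S.U) (hT : 1 ≤ T) (hℓ : 1 ≤ ℓ)
    (hn : 14 * ℓ * ‖S.B‖ * S.inputBound * Real.log (2 * T * ℓ * Pol.card / δ) / (S.ε * δ)
      ≤ (n : ℝ)) :
    ∃ N : Set Ω, μ.real N ≤ δ ∧ ∀ ω ∉ N, D.real (F.closeEvent ω)ᶜ ≤ δ / ℓ := by
  obtain hsmall | hlarge := le_or_gt (2 * (‖S.B‖ * S.inputBound)) S.ε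
  · refine ⟨∅, by simpa using hδ0.le, fun ω _ => ?_⟩
    rw [F.measureReal_closeEvent_compl_eq_zero hC hCX hDC hε.le hU hsmall hexpert hPol_input]
    positivity
  have hℓ' : (1 : ℝ) ≤ ℓ := Nat.one_le_cast.2 hℓ
  have hT' : (1 : ℝ) ≤ T := Nat.one_le_cast.2 hT
  have hcard : (1 : ℝ) ≤ Pol.card := Nat.one_le_cast.2 (Finset.card_pos.2 ⟨_, hexpert⟩)
  set a : ℝ := 2 * T * ℓ * Pol.card / δ with ha
  have ha1 : 1 < a := by
    have : (1 : ℝ) ≤ T * ℓ * Pol.card :=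
      one_le_mul_of_one_le_of_one_le (one_le_mul_of_one_le_of_one_le hT' hℓ') hcard
    rw [ha, one_lt_div hδ0]
    linarith
  have hlog : 0 < Real.log a := Real.log_pos ha1
  have hn7 : 7 * ℓ * Real.log a / δ ≤ n := by
    refine le_trans ?_ hn
    rw [div_le_div_iff₀ hδ0 (by positivity)]
    calc 7 * ℓ * Real.log a * (S.ε * δ) = 7 * ℓ * Real.log a * δ * S.ε := by ring
      _ ≤ 7 * ℓ * Real.log a * δ * (2 * (‖S.B‖ * S.inputBound)) := by gcongr
      _ = 14 * ℓ * ‖S.B‖ * S.inputBound * Real.log a * δ := by ring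
  have hn0 : 0 < n := Nat.cast_pos.1 (lt_of_lt_of_le (by positivity) hn7)
  refine ⟨_, (F.measureReal_biUnion_misleadingTrain_le hexpert hPol_meas hn0
    (zero_lt_one.trans ha1)).trans ?_, fun ω hω =>
      (F.measureReal_closeEvent_compl_le hε.le hexpert hω).trans
        (sum_div_sampleSize_le hlog.le hn0 ?_ _)⟩
  · calc T * (Pol.card / a) = δ / (2 * ℓ) := by
          rw [ha]
          field_simp
      _ ≤ δ := div_le_self hδ0.le (by linarith)
  · rw [div_le_iff₀ hδ0] at hn7
    rw [div_mul_eq_mul_div, le_div_iff₀ (by positivity)]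
    nlinarith

lemma exists_measurableSet_forall_notMem [IsProbabilityMeasure D] [IsProbabilityMeasure μ]
    {C : Set (Vec dx)} (hC : S.IsRobustlyInvariant expert C) (hCX : C ⊆ S.X)
    (hDC : ∀ᵐ x ∂D, x ∈ C) (hO : MeasurableSet S.Obar) (hε : 0 < S.ε)
    (hU : Bornology.IsBounded S.U) {δ : ℝ} (hδ0 : 0 < δ) (hδ1 : δ < 1) (hexpert : expert ∈ Pol)
    (hPol_meas : ∀ p ∈ Pol, Measurable p) (hPol_input : ∀ p ∈ Pol, ∀ x ∈ S.X, p x ∈ S.U)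
    (hT : 1 ≤ T) (hℓ : 1 ≤ ℓ)
    (hn : 14 * ℓ * ‖S.B‖ * S.inputBound * Real.log (2 * T * ℓ * Pol.card / δ) / (S.ε * δ)
      ≤ (n : ℝ))
    (hl : Real.log (T / δ) ≤ δ * ℓ) (k : ℕ) :
    ∃ G : Set Ω, MeasurableSet G ∧ 1 - 3 * δ ≤ μ.real G ∧ ∀ ω ∈ G,
      D.real (F.closeEvent ω)ᶜ ≤ δ / ℓ ∧ (ω ∉ ⋃ t ∈ Finset.range T, F.falsePass t δ) ∧
        ω ∉ F.falseFail k (δ / ℓ) := by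
  obtain ⟨N, hN, hclose⟩ := F.exists_measureReal_closeEvent_compl_le hC hCX hDC hε hU hδ0 hδ1
    hexpert hPol_meas hPol_input hT hℓ hn
  have hPass := F.measureReal_biUnion_falsePass_le hO hPol_meas hT hδ0 hl
  have hFail : μ.real (F.falseFail k (δ / ℓ)) ≤ δ :=
    (F.measureReal_falseFail_le hO hPol_meas k (by positivity)).trans_eq
      (mul_div_cancel₀ _ (by positivity))
  have hbad : μ.real (N ∪ (⋃ t ∈ Finset.range T, F.falsePass t δ) ∪ F.falseFail k (δ / ℓ)) ≤
      3 * δ :=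
    calc _ ≤ δ + δ + δ := (measureReal_union_le _ _).trans
          (add_le_add ((measureReal_union_le _ _).trans (add_le_add hN hPass)) hFail)
      _ = 3 * δ := by ring
  obtain ⟨G, hG, hGδ, hGsub⟩ := exists_measurableSet_subset_compl_of_measureReal_le hbad
  refine ⟨G, hG, hGδ, fun ω hω => ?_⟩
  have hω' := hGsub hω
  simp only [Set.mem_compl_iff, Set.mem_union, not_or] at hω'
  exact ⟨hclose ω hω'.1.1, hω'.1.2, hω'.2⟩

section SwitchingTime

variable [IsProbabilityMeasure D] {ω : Ω}

lemma tauHat_le_tauStar (hε : 0 ≤ S.ε) {β : ℝ} (hclose : D.real (F.closeEvent ω)ᶜ ≤ β)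
    (hω : ω ∉ F.falseFail ((S.tauStar D expert).toNat - 1) β) :
    (F.tauHat ω : ℕ∞) ≤ S.tauStar D expert := by
  by_cases htop : S.tauStar D expert = ⊤
  · exact htop ▸ le_top
  obtain ⟨t, ht, hmem⟩ := MPCData.exists_tauStar_eq htop
  rw [ht, ENat.toNat_natCast, Nat.add_sub_cancel] at hω
  rw [ht, Nat.cast_le]
  by_contra! hlt
  refine hω ⟨(MPCData.measureReal_reachSet_compl_le hε hmem hlt.le _).trans hclose, ?_⟩
  by_contra! hpass
  exact hlt.not_ge (MPCData.switchTime_le_succ fun i => Set.notMem_compl_iff.1 (hpass i))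

lemma one_sub_le_measureReal_reachEvent (hε : 0 ≤ S.ε) {δ : ℝ}
    (hclose : D.real (F.closeEvent ω)ᶜ ≤ δ) (hle : (F.tauHat ω : ℕ∞) ≤ S.tauStar D expert)
    (hω : ω ∉ ⋃ t ∈ Finset.range T, F.falsePass t δ)
    (h : S.tauStar D expert ≤ (T : ℕ∞) ∨ F.tauHat ω < T) :
    1 - δ ≤ D.real (F.reachEvent ω) := by
  obtain hlt | hge := lt_or_ge (F.tauHat ω) T
  · obtain ⟨t, ht, hpass⟩ := MPCData.exists_of_switchTime_lt hlt
    have ht' : F.tauHat ω = t + 1 := ht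
    by_contra! hrare
    rw [reachEvent, ht'] at hrare
    exact hω (Set.mem_biUnion (Finset.mem_coe.2 (Finset.mem_range.2 (by omega))) ⟨hrare, hpass⟩)
  · have hT := h.resolve_right hge.not_gt
    obtain ⟨t, ht, hmem⟩ :=
      MPCData.exists_tauStar_eq (ne_top_of_le_ne_top (ENat.natCast_ne_top T) hT)
    rw [ht, Nat.cast_le] at hT hle
    rw [← le_antisymm hle (hT.trans hge)] at hmem
    have hmiss := MPCData.measureReal_reachSet_compl_le hε hmem le_rfl (F.learned ω)
    exact (sub_le_sub_left (hmiss.trans hclose) 1).trans (one_sub_measureReal_compl_le _)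

end SwitchingTime

end ForwardSwitch

theorem theorem2_general {dx du : ℕ} (S : MPCData dx du) (hN : 1 ≤ S.N) (hX : IsClosed S.X)
    (hU : IsClosed S.U) (hU_bdd : Bornology.IsBounded S.U) (hE : S.IsDisturbanceInvariant)
    (hε : 0 < S.ε) (δ : ℝ) (hδ : δ ∈ Set.Ioo (0 : ℝ) 1)
    (D : Measure (Vec dx)) [IsProbabilityMeasure D] (hD : ∀ᵐ x ∂D, x ∈ S.rmpcDomain)
    (expert : Policy dx du) (hexpert : S.IsFeasibleRobustMPC expert)
    (Pol : Finset (Policy dx du)) (hPol_expert : expert ∈ Pol)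
    (hPol_meas : ∀ p ∈ Pol, Measurable p)
    (hPol_input : ∀ p ∈ Pol, ∀ x ∈ S.X, p x ∈ S.U)
    (n T ℓ : ℕ) (hT : 1 ≤ T)
    (hn : 14 * ℓ * ‖S.B‖ * S.inputBound * Real.log (2 * T * ℓ * Pol.card / δ) / (S.ε * δ)
      ≤ (n : ℝ))
    (hl : 10 * Real.log (T / δ) / δ ≤ (ℓ : ℝ))
    {Ω : Type*} [MeasurableSpace Ω] (μ : Measure Ω) [IsProbabilityMeasure μ]
    (F : ForwardSwitch S D Pol expert n T ℓ μ) :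
    ((∀ᵐ x ∂D, x ∈ S.feasibleDomain) → (∃ r : ℝ, ∀ᵐ x ∂D, ‖x‖ ≤ r) → S.IsRobustMPC expert →
      S.Q.PosDef → S.R.PosDef → S.P.PosSemidef → S.Riccati →
      (0 : Vec dx) ∈ interior (erode S.Obar S.E) → S.tauStar D expert ≠ ⊤) ∧
    ∃ G : Set Ω, MeasurableSet G ∧ 1 - 3 * δ ≤ μ.real G ∧ ∀ ω ∈ G,
      (F.tauHat ω : ℕ∞) ≤ S.tauStar D expert ∧
      (S.tauStar D expert ≤ (T : ℕ∞) ∨ F.tauHat ω < T →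
        1 - δ ≤ D.real (F.reachEvent ω)) ∧
      1 - δ ≤ D.real (F.closeEvent ω) ∧
      ∀ x₀ ∈ S.rmpcDomain, x₀ ∈ F.reachEvent ω → x₀ ∈ F.closeEvent ω →
        ∀ t, S.traj (F.output ω) x₀ t ∈ S.X ∧
          F.output ω t (S.traj (F.output ω) x₀ t) ∈ S.U := by
  refine ⟨fun hD_feas hD_bdd hopt hQ hR hP hRic h0 =>
    MPCData.tauStar_ne_top hN hU_bdd hE hQ hR hP hRic hopt h0 hD_feas hD_bdd, ?_⟩
  obtain ⟨hδ0, hδ1⟩ := hδ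
  have hlog : 0 < Real.log (T / δ) :=
    Real.log_pos ((one_lt_div hδ0).2 (hδ1.trans_le (Nat.one_le_cast.2 hT)))
  have hℓ : 1 ≤ ℓ := Nat.cast_pos.1 (lt_of_lt_of_le (by positivity) hl)
  rw [div_le_iff₀' hδ0] at hl
  have hinv := hexpert.isRobustlyInvariant_rmpcDomain hN hE
  have hdom : S.rmpcDomain ⊆ S.X := fun _ hx => hx.1
  obtain ⟨G, hG, hGδ, hgood⟩ := F.exists_measurableSet_forall_notMem hinv hdom hD
    (MPCData.isClosed_Obar hX hU).measurableSet hε hU_bdd hδ0 hδ1 hPol_expert hPol_meas hPol_input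
    hT hℓ hn (by linarith) ((S.tauStar D expert).toNat - 1)
  refine ⟨G, hG, hGδ, fun ω hω => ?_⟩
  obtain ⟨hclose, hpass, hfail⟩ := hgood ω hω
  have hclose_δ := hclose.trans (div_le_self hδ0.le (Nat.one_le_cast.2 hℓ))
  have hτ := F.tauHat_le_tauStar hε.le hclose hfail
  exact ⟨hτ, F.one_sub_le_measureReal_reachEvent hε.le hclose_δ hτ hpass,
    (sub_le_sub_left hclose_δ 1).trans (one_sub_measureReal_compl_le _),
    fun x₀ hx₀ hreach hcl => hinv.switched_safe hdom hε.le
      (fun t => hPol_input _ (F.policy_mem t ω)) hx₀ hreach hcl⟩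

theorem theorem2 {dx du : ℕ} (S : MPCData dx du) (hS : S.Standing)
    (hε : S.ε ∈ Set.Ioo (0 : ℝ) 1) (δ : ℝ) (hδ : δ ∈ Set.Ioo (0 : ℝ) 1)
    (D : Measure (Vec dx)) [IsProbabilityMeasure D]
    (hD_feas : ∀ᵐ x ∂D, x ∈ S.feasibleDomain)
    (hD_bdd : ∃ r : ℝ, ∀ᵐ x ∂D, ‖x‖ ≤ r)
    (expert : Policy dx du) (hexpert : S.IsRobustMPC expert)
    (Pol : Finset (Policy dx du)) (hPol_expert : expert ∈ Pol)
    (hPol_meas : ∀ p ∈ Pol, Measurable p)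
    (hPol_input : ∀ p ∈ Pol, ∀ x ∈ S.X, p x ∈ S.U)
    (n T ℓ : ℕ) (hT : 1 ≤ T)
    (hn : 14 * ℓ * ‖S.B‖ * S.inputBound * Real.log (2 * T * ℓ * Pol.card / δ) / (S.ε * δ)
      ≤ (n : ℝ))
    (hl : 10 * Real.log (T / δ) / δ ≤ (ℓ : ℝ))
    {Ω : Type*} [MeasurableSpace Ω] (μ : Measure Ω) [IsProbabilityMeasure μ]
    (F : ForwardSwitch S D Pol expert n T ℓ μ) :
    (S.Q.PosDef → (0 : Vec dx) ∈ interior (erode S.Obar S.E) → S.tauStar D expert ≠ ⊤) ∧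
    ∃ G : Set Ω, MeasurableSet G ∧ 1 - 3 * δ ≤ μ.real G ∧ ∀ ω ∈ G,
      (F.tauHat ω : ℕ∞) ≤ S.tauStar D expert ∧
      (S.tauStar D expert ≤ (T : ℕ∞) ∨ F.tauHat ω < T →
        1 - δ ≤ D.real (F.reachEvent ω)) ∧
      1 - δ ≤ D.real (F.closeEvent ω) ∧
      ∀ x₀ ∈ S.feasibleDomain, x₀ ∈ F.reachEvent ω → x₀ ∈ F.closeEvent ω →
        ∀ t, S.traj (F.output ω) x₀ t ∈ S.X ∧
          F.output ω t (S.traj (F.output ω) x₀ t) ∈ S.U := by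
  have hdom := MPCData.feasibleDomain_subset_rmpcDomain hS.E_inv.zero_mem
  obtain ⟨hfinite, G, hG, hGδ, hgood⟩ := theorem2_general S hS.N_pos hS.X_closed hS.U_closed
    hS.U_bdd hS.E_inv hε.1 δ hδ D (hD_feas.mono hdom) expert hexpert.isFeasibleRobustMPC Pol
    hPol_expert hPol_meas hPol_input n T ℓ hT hn hl μ F
  refine ⟨fun hQ => hfinite hD_feas hD_bdd hexpert hQ hS.R_pd hS.P_pd.posSemidef hS.riccati,
    G, hG, hGδ, fun ω hω => ?_⟩
  obtain ⟨htau, hreach, hclose, hsafe⟩ := hgood ω hω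
  exact ⟨htau, hreach, hclose, fun x₀ hx₀ => hsafe x₀ (hdom hx₀)⟩
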